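/- A surface here is a smooth immersion $f\colon\Sigma\to\mathbb R^3\setminus\{0\}$ of a connected smooth $2$-manifold $\Sigma$ with boundary, smooth up to the boundary. It is called $-4$-stationary if $$H(p)=-4\,\frac{\langle \nu(p),f(p)\rangle}{|f(p)|^2}\qquad\text{for all }p\in\Sigma,$$ where $\nu(p)$ is a unit normal vector at $p$ and $H(p)$ is the mean curvature with respect to $\nu(p)$, i.e. the sum of the principal curvatures (a sphere of radius $r$ has $H=2/r$ with respect to the inward normal); the equation does not depend on the sign of $\nu(p)$. **Theorem.** (i) Let $f\colon\Sigma\to\mathbb R^3\setminus\{0\}$ be a compact $-4$-stationary surface whose boundary is a circle, that is, $f(\partial\Sigma)=\Gamma$ for a round circle $\Gamma\subset\mathbb R^3$ of positive radius. Then $f$ is injective, and $f(\Sigma)$ is either a closed round disc, bounded by $\Gamma$, of a plane through the origin, or a closed spherical cap, bounded by $\Gamma$, of a sphere passing through the origin. (ii) Conversely, let $D$ be a closed round disc of positive radius in a plane through the origin, or a closed spherical cap (bounded by a circle of positive radius) of a sphere passing through the origin, and assume $0\notin D$. Then the boundary curve $\Gamma$ of $D$ is a circle, and $D$ is the image of an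 injective compact $-4$-stationary surface $f$ that has a continuous unit normal field and satisfies $f(\partial\Sigma)=\Gamma$. -/

import Mathlib

open Set
open scoped Manifold ContDiff InnerProductSpace

noncomputable section

namespace StationarySurface

/-- Euclidean three-space. -/
abbrev E3 : Type := EuclideanSpace ℝ (Fin 3)

section Immersed

variable {M : Type*} [TopologicalSpace M] [ChartedSpace (EuclideanHalfSpace 2) M]

/-- The map `f`, read in the preferred chart of the surface (with boundary) `M` around `p`. It is
defined on the closed half-plane `range (𝓡∂ 2)`, near the image of `p`. -/
def localRep (f : M → E3) (p : M) : EuclideanSpace ℝ (Fin 2) → E3 :=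
  f ∘ (extChartAt (𝓡∂ 2) p).symm

/-- The `i`-th partial derivative of `f` in the preferred chart around `p`, at a point `x` of the
half-plane (one-sided derivatives at boundary points). -/
def partialDeriv (f : M → E3) (p : M) (i : Fin 2) (x : EuclideanSpace ℝ (Fin 2)) : E3 :=
  fderivWithin ℝ (localRep f p) (range (𝓡∂ 2)) x (EuclideanSpace.single i 1)

/-- The second partial derivative `∂ᵢ∂ⱼ f` in the preferred chart around `p`, at a point `x` of the
half-plane. -/
def partialDeriv₂ (f : M → E3) (p : M) (i j : Fin 2) (x : EuclideanSpace ℝ (Fin 2)) : E3 :=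
  fderivWithin ℝ (partialDeriv f p j) (range (𝓡∂ 2)) x (EuclideanSpace.single i 1)

/-- The matrix `gᵢⱼ = ⟨∂ᵢf, ∂ⱼf⟩` of the first fundamental form at `p`. -/
def firstFundamentalForm (f : M → E3) (p : M) : Matrix (Fin 2) (Fin 2) ℝ :=
  Matrix.of fun i j =>
    ⟪partialDeriv f p i (extChartAt (𝓡∂ 2) p p), partialDeriv f p j (extChartAt (𝓡∂ 2) p p)⟫_ℝ

/-- The matrix `bᵢⱼ = ⟨∂ᵢ∂ⱼf, ν⟩` of the second fundamental form at `p` with respect to the unit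
normal vector `ν`. -/
def secondFundamentalForm (f : M → E3) (p : M) (ν : E3) : Matrix (Fin 2) (Fin 2) ℝ :=
  Matrix.of fun i j => ⟪partialDeriv₂ f p i j (extChartAt (𝓡∂ 2) p p), ν⟫_ℝ

/-- The mean curvature at `p` with respect to the unit normal vector `ν`: the sum of the principal
curvatures, that is, the trace of the shape operator `g⁻¹ b`. A round sphere of radius `r` has mean
curvature `2 / r` with respect to the inward normal. -/
def meanCurvature (f : M → E3) (p : M) (ν : E3) : ℝ :=
  ((firstFundamentalForm f p)⁻¹ * secondFundamentalForm f p ν).trace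

/-- `ν` is a unit vector orthogonal to the tangent plane of the immersion `f` at `p`. -/
def IsUnitNormal (f : M → E3) (p : M) (ν : E3) : Prop :=
  ‖ν‖ = 1 ∧ ∀ v : TangentSpace (𝓡∂ 2) p, ⟪ν, (mfderiv (𝓡∂ 2) 𝓘(ℝ, E3) f p v : E3)⟫_ℝ = 0

/-- `f : M → ℝ³ ∖ {0}` is an `α`-stationary immersed surface: a smooth immersion (up to the
boundary of `M`) with `H = α ⟨ν, p⟩ / |p|²` at each point. Both sides of the equation change sign
with the unit normal `ν`, so that it does not depend on the choice of `ν`. -/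
structure IsStationary (α : ℝ) (f : M → E3) : Prop where
  smooth : ContMDiff (𝓡∂ 2) 𝓘(ℝ, E3) ∞ f
  immersion : ∀ p : M, Function.Injective (mfderiv (𝓡∂ 2) 𝓘(ℝ, E3) f p)
  ne_zero : ∀ p : M, f p ≠ 0
  meanCurvature_eq : ∀ (p : M) (ν : E3), IsUnitNormal f p ν →
    meanCurvature f p ν = α * ⟪ν, f p⟫_ℝ / ‖f p‖ ^ 2

end Immersed

/-- `Γ` is a (round) circle of `ℝ³`, of positive radius. -/
def IsCircle (Γ : Set E3) : Prop :=
  ∃ (c n : E3) (r : ℝ), ‖n‖ = 1 ∧ 0 < r ∧ Γ = {x | ⟪n, x - c⟫_ℝ = 0 ∧ ‖x - c‖ = r}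

/-- `D` is a closed round disc of a vector plane `{x | ⟨n, x⟩ = 0}`, bounded by the circle `Γ`. -/
def IsVectorPlaneDisc (D Γ : Set E3) : Prop :=
  ∃ (c n : E3) (r : ℝ), ‖n‖ = 1 ∧ ⟪n, c⟫_ℝ = 0 ∧ 0 < r ∧
    D = {x | ⟪n, x⟫_ℝ = 0 ∧ ‖x - c‖ ≤ r} ∧ Γ = {x | ⟪n, x⟫_ℝ = 0 ∧ ‖x - c‖ = r}

/-- `D` is a closed spherical cap, bounded by the circle `Γ`, of a sphere passing through the origin
(the sphere with center `a ≠ 0` and radius `‖a‖`): one of the two parts into which the sphere is cut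
by a plane `{x | ⟨n, x⟩ = t}` at distance less than the radius from the center. -/
def IsCapOfSphereThroughOrigin (D Γ : Set E3) : Prop :=
  ∃ (a n : E3) (t : ℝ), a ≠ 0 ∧ ‖n‖ = 1 ∧ |t - ⟪n, a⟫_ℝ| < ‖a‖ ∧
    D = {x | ‖x - a‖ = ‖a‖ ∧ t ≤ ⟪n, x⟫_ℝ} ∧ Γ = {x | ‖x - a‖ = ‖a‖ ∧ ⟪n, x⟫_ℝ = t}

end StationarySurface

end

/-! The inversion y = x/|x|² turns the equation H = -4⟨ν,x⟩/|x|² into H = 0, and the planes and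
spheres through the origin, i.e. the sets ⟨b,x⟩ = t|x|² with b ≠ 0, into the planes ⟨b,y⟩ = t. Every
circle lies in such a set (`IsCircle.exists_disc`). On a minimal surface ⟨b,y⟩ is harmonic, so a
compact minimal surface with boundary in a plane lies in that plane.

The maximum principle is carried out without inverting the surface. The strictly subharmonic
function ⟨b,y⟩ + ε|y|² reads (⟨b,x⟩ + ε)/|x|² in the original variable. If its maximum is m, then
`quad b ε m` is nonpositive on the surface and vanishes at the maximum point. The trace of its
Hessian at an interior such point is 4ε/|f|², which cannot be positive
(`IsStationary.nonpos_of_isLocalMax`). So the maximum is on the boundary, and ε → 0 gives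
`IsStationary.inner_eq_of_boundary`.

What remains is topology. In planar coordinates on the plane or sphere, the surface becomes an
immersion of a compact connected surface into ℝ² that takes the boundary onto the unit circle. Such
a map is a local homeomorphism onto the closed disc, hence a covering of a simply connected space,
hence injective (`injective_and_range_eq_closedBall`).

For the converse, the same Hessian trace is applied to a quadratic function vanishing identically on
the surface (`isStationary_of_inner_eq`), and the closed disc is made a manifold with boundary by
Cayley transforms. -/

namespace StationarySurface

/-! ### Linear algebra of 2 × 2 matrices -/

theorem trace_inv_mul_nonpos {G W : Matrix (Fin 2) (Fin 2) ℝ} (hG : G.PosDef)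
    (hW : ∀ v : Fin 2 → ℝ, v ⬝ᵥ W.mulVec v ≤ 0) : (G⁻¹ * W).trace ≤ 0 := by
  have hdet := hG.det_pos
  have h00 : 0 < G 0 0 := hG.diag_pos
  have hsymm : G 1 0 = G 0 1 := by simpa using hG.1.apply 0 1
  rw [Matrix.det_fin_two] at hdet
  -- For v = (-g₀₁, g₀₀) one has g₀₀ · tr(adj G · W) = vᵀWv + det G · w₀₀.
  have h1 := hW ![-G 0 1, G 0 0]
  have h2 := hW ![1, 0]
  simp [dotProduct, Matrix.mulVec, Fin.sum_univ_two] at h1 h2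
  rw [Matrix.inv_def, Matrix.smul_mul, Matrix.trace_smul, Matrix.det_fin_two, Ring.inverse_eq_inv',
    smul_eq_mul]
  refine mul_nonpos_of_nonneg_of_nonpos (inv_nonneg.2 hdet.le) ?_
  rw [Matrix.adjugate_fin_two, Matrix.trace_fin_two]
  simp [Matrix.mul_apply, Fin.sum_univ_two]
  refine nonpos_of_mul_nonpos_right ?_ h00
  rw [hsymm] at hdet ⊢
  nlinarith [mul_nonneg hdet.le (neg_nonneg.2 h2)]

theorem trace_inv_mul_of_eq {G B W : Matrix (Fin 2) (Fin 2) ℝ} (hG : G.PosDef) {a m : ℝ}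
    (hW : W = a • B - (2 * m) • G) : (G⁻¹ * W).trace = a * (G⁻¹ * B).trace - 4 * m := by
  rw [hW, mul_sub, Matrix.mul_smul, Matrix.mul_smul, Matrix.nonsing_inv_mul _
    (isUnit_iff_ne_zero.2 hG.det_pos.ne'), Matrix.trace_sub, Matrix.trace_smul, Matrix.trace_smul,
    Matrix.trace_one, smul_eq_mul, smul_eq_mul, Fintype.card_fin]
  push_cast
  ring

/-! ### Derivatives of quadratic functions along a map -/

section Calculus

variable {E F : Type*} [NormedAddCommGroup E] [NormedSpace ℝ E] [NormedAddCommGroup F]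
  [InnerProductSpace ℝ F] {s T : Set E} {φ : E → F} {y : E}

/-- The function `⟨b, x⟩ + e - m |x|²`. -/
def quad (b : F) (e m : ℝ) (x : F) : ℝ := ⟪b, x⟫_ℝ + e - m * ⟪x, x⟫_ℝ

theorem contDiff_quad (b : F) (e m : ℝ) {n : WithTop ℕ∞} : ContDiff ℝ n (quad b e m) := by
  unfold quad
  exact ((contDiff_const.inner ℝ contDiff_id).add contDiff_const).sub
    (contDiff_const.mul (contDiff_id.inner ℝ contDiff_id))

theorem fderivWithin_quad_comp (b : F) (e m : ℝ) (hs : UniqueDiffWithinAt ℝ s y)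
    (hφ : DifferentiableWithinAt ℝ φ s y) (v : E) :
    fderivWithin ℝ (fun z => quad b e m (φ z)) s y v
      = ⟪b - (2 * m) • φ y, fderivWithin ℝ φ s y v⟫_ℝ := by
  have h := hφ.hasFDerivWithinAt
  have h1 : HasFDerivWithinAt (fun z => quad b e m (φ z)) _ s y :=
    (((hasFDerivWithinAt_const b y s).inner ℝ h).add_const e).sub ((h.inner ℝ h).const_mul m)
  rw [h1.fderivWithin hs]
  simp [inner_sub_left, real_inner_smul_left, real_inner_comm]
  ring

theorem fderivWithin_fderivWithin_quad_comp (b : F) (e m : ℝ) (hs : UniqueDiffOn ℝ s)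
    (hφ : ContDiffWithinAt ℝ 2 φ s y) (hy : y ∈ s) (u v : E) :
    fderivWithin ℝ (fun z => fderivWithin ℝ (fun z => quad b e m (φ z)) s z v) s y u
      = ⟪b - (2 * m) • φ y, fderivWithin ℝ (fun z => fderivWithin ℝ φ s z v) s y u⟫_ℝ
        - 2 * m * ⟪fderivWithin ℝ φ s y u, fderivWithin ℝ φ s y v⟫_ℝ := by
  have hev : ∀ᶠ z in nhdsWithin y s, ContDiffWithinAt ℝ 2 φ s z := by
    have := hφ.eventually (by simp)
    rwa [insert_eq_of_mem hy] at this
  have heq : (fun z => fderivWithin ℝ (fun z => quad b e m (φ z)) s z v)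
      =ᶠ[nhdsWithin y s] fun z => ⟪b - (2 * m) • φ z, fderivWithin ℝ φ s z v⟫_ℝ := by
    filter_upwards [hev, self_mem_nhdsWithin] with z hz hzs
    exact fderivWithin_quad_comp b e m (hs z hzs) (hz.differentiableWithinAt (by norm_num)) v
  rw [heq.fderivWithin_eq (heq.self_of_nhdsWithin hy)]
  have h := (hφ.differentiableWithinAt (by norm_num)).hasFDerivWithinAt
  have h' : DifferentiableWithinAt ℝ (fun z => fderivWithin ℝ φ s z v) s y :=
    ((hφ.fderivWithin_right (m := 1) hs (by norm_num) hy).differentiableWithinAt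
      (by norm_num)).clm_apply (differentiableWithinAt_const v)
  have h1 := (((hasFDerivWithinAt_const b y s).sub (h.const_smul (2 * m))).inner ℝ
    h'.hasFDerivWithinAt)
  refine (congrArg (fun A : E →L[ℝ] ℝ => A u) (h1.fderivWithin (hs y hy))).trans ?_
  simp [inner_sub_left, real_inner_smul_left, real_inner_smul_right, real_inner_comm]
  ring

/-- The second derivative of a function at a local maximum is nonpositive. -/
theorem deriv_deriv_nonpos_of_isLocalMax {g : ℝ → ℝ} {x : ℝ} (h : IsLocalMax g x)
    (hc : ContinuousAt g x) : deriv (deriv g) x ≤ 0 := by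
  by_contra! hpos
  -- A positive second derivative makes the point a local minimum as well, so g is locally constant
  -- there.
  have hmin := isLocalMin_of_deriv_deriv_pos hpos h.deriv_eq_zero hc
  have hconst : g =ᶠ[nhds x] fun _ => g x := by
    filter_upwards [h, hmin] with y h1 h2 using le_antisymm h1 h2
  have := hconst.deriv.deriv_eq
  simp at this
  exact hpos.ne' this

theorem fderiv_fderiv_nonpos_of_isLocalMax {w : E → ℝ} (h : IsLocalMax w y)
    (hw : ContDiffAt ℝ 2 w y) (v : E) : fderiv ℝ (fun z => fderiv ℝ w z v) y v ≤ 0 := by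
  have hline : ∀ t : ℝ, HasDerivAt (fun t : ℝ => y + t • v) v t := fun t => by
    simpa using ((hasDerivAt_id t).smul_const v).const_add y
  have hcont : ContinuousAt (fun t : ℝ => y + t • v) 0 := (hline 0).continuousAt
  have h0 : Filter.Tendsto (fun t : ℝ => y + t • v) (nhds 0) (nhds y) := by
    simpa [ContinuousAt] using hcont
  have hev : ∀ᶠ t : ℝ in nhds 0, ContDiffAt ℝ 2 w (y + t • v) :=
    h0.eventually (hw.eventually (by simp))
  have h1 : deriv (fun t : ℝ => w (y + t • v)) =ᶠ[nhds 0]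
      fun t => fderiv ℝ w (y + t • v) v := by
    filter_upwards [hev] with t ht
    exact ((ht.differentiableAt (by norm_num)).hasFDerivAt.comp_hasDerivAt t (hline t)).deriv
  have hd : DifferentiableAt ℝ (fun z => fderiv ℝ w z v) (y + (0 : ℝ) • v) := by
    simpa using ((hw.fderiv_right (m := 1) (by norm_num)).differentiableAt
      (by norm_num)).clm_apply (differentiableAt_const v)
  have h2 := (hd.hasFDerivAt.comp_hasDerivAt (0 : ℝ) (hline 0)).deriv
  have h3 : IsLocalMax (fun t : ℝ => w (y + t • v)) 0 := by
    filter_upwards [h0.eventually h] with t ht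
    simpa using ht
  have h4 := deriv_deriv_nonpos_of_isLocalMax h3
    (ContinuousAt.comp (g := w) (by simpa using hw.continuousAt) hcont)
  rw [h1.deriv_eq] at h4
  have h5 : deriv (fun t : ℝ => fderiv ℝ w (y + t • v) v) 0 = _ := h2
  rw [h5] at h4
  simpa using h4

theorem injective_fderiv_of_eventually_leftInverse {G : Type*} [NormedAddCommGroup G]
    [NormedSpace ℝ G] {g : E → G} {k : G → E} (hg : DifferentiableAt ℝ g y)
    (hk : DifferentiableAt ℝ k (g y)) (h : ∀ᶠ x in nhds y, k (g x) = x) :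
    Function.Injective (fderiv ℝ g y) := by
  have h2 : (fderiv ℝ k (g y)).comp (fderiv ℝ g y) = ContinuousLinearMap.id ℝ E := by
    rw [← fderiv_comp _ hk hg]
    exact (Filter.EventuallyEq.fderiv_eq (f₁ := k ∘ g) (f := id) h).trans fderiv_id
  exact Function.LeftInverse.injective (g := fderiv ℝ k (g y)) fun v => DFunLike.congr_fun h2 v

end Calculus

/-! ### Immersed surfaces in the preferred charts -/

section Charts

variable {M : Type*} [TopologicalSpace M] [ChartedSpace (EuclideanHalfSpace 2) M]

section NormedSpace

variable {F : Type*} [NormedAddCommGroup F] [NormedSpace ℝ F] {f : M → F}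

theorem contDiffWithinAt_comp_extChartAt_symm [IsManifold (𝓡∂ 2) ∞ M]
    (hf : ContMDiff (𝓡∂ 2) 𝓘(ℝ, F) ∞ f) (p : M)
    {y : EuclideanSpace ℝ (Fin 2)} (hy : y ∈ (extChartAt (𝓡∂ 2) p).target) :
    ContDiffWithinAt ℝ ∞ (f ∘ (extChartAt (𝓡∂ 2) p).symm) (range (𝓡∂ 2)) y := by
  rw [← contMDiffWithinAt_iff_contDiffWithinAt]
  exact (hf _).comp_contMDiffWithinAt y (contMDiffWithinAt_extChartAt_symm_range p hy)

theorem mfderiv_eq_fderivWithin (hf : ContMDiff (𝓡∂ 2) 𝓘(ℝ, F) ∞ f) (p : M) :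
    mfderiv (𝓡∂ 2) 𝓘(ℝ, F) f p
      = fderivWithin ℝ (f ∘ (extChartAt (𝓡∂ 2) p).symm) (range (𝓡∂ 2))
        (extChartAt (𝓡∂ 2) p p) := by
  exact ((hf p).mdifferentiableAt (by simp)).mfderiv

/-- The derivative of a map at `p`, read in the preferred chart around `p`. -/
noncomputable def chartDeriv (f : M → F) (p : M) : EuclideanSpace ℝ (Fin 2) →L[ℝ] F :=
  fderivWithin ℝ (f ∘ (extChartAt (𝓡∂ 2) p).symm) (range (𝓡∂ 2)) (extChartAt (𝓡∂ 2) p p)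

theorem injective_mfderiv_iff (hf : ContMDiff (𝓡∂ 2) 𝓘(ℝ, F) ∞ f) (p : M) :
    Function.Injective (mfderiv (𝓡∂ 2) 𝓘(ℝ, F) f p) ↔ Function.Injective (chartDeriv f p) := by
  rw [mfderiv_eq_fderivWithin hf]
  rfl

theorem chartDeriv_comp [IsManifold (𝓡∂ 2) ∞ M] {G : Type*} [NormedAddCommGroup G]
    [NormedSpace ℝ G] {k : F → G} (hf : ContMDiff (𝓡∂ 2) 𝓘(ℝ, F) ∞ f) (p : M)
    (hk : DifferentiableAt ℝ k (f p)) :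
    chartDeriv (k ∘ f) p = (fderiv ℝ k (f p)).comp (chartDeriv f p) := by
  have hp : (f ∘ (extChartAt (𝓡∂ 2) p).symm) (extChartAt (𝓡∂ 2) p p) = f p :=
    congrArg f (extChartAt_to_inv p)
  have h := fderiv_comp_fderivWithin (𝕜 := ℝ) (f := f ∘ (extChartAt (𝓡∂ 2) p).symm) (g := k)
    (extChartAt (𝓡∂ 2) p p) (by rwa [hp])
    ((contDiffWithinAt_comp_extChartAt_symm hf p (mem_extChartAt_target p)).differentiableWithinAt
      (by simp)) ((𝓡∂ 2).uniqueDiffOn _ (mem_range_self _))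
  rw [hp] at h
  exact h

end NormedSpace

variable {f : M → E3}

@[simp]
theorem localRep_extChartAt (f : M → E3) (p : M) :
    localRep f p (extChartAt (𝓡∂ 2) p p) = f p :=
  congrArg f (extChartAt_to_inv p)

theorem firstFundamentalForm_posDef (hf : ContMDiff (𝓡∂ 2) 𝓘(ℝ, E3) ∞ f) {p : M}
    (hinj : Function.Injective (mfderiv (𝓡∂ 2) 𝓘(ℝ, E3) f p)) :
    (firstFundamentalForm f p).PosDef := by
  have hlin : LinearIndependent ℝ
      (fun i : Fin 2 => partialDeriv f p i (extChartAt (𝓡∂ 2) p p)) := by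
    rw [mfderiv_eq_fderivWithin hf] at hinj
    have := (EuclideanSpace.basisFun (Fin 2) ℝ).orthonormal.linearIndependent.map'
      (fderivWithin ℝ (f ∘ (extChartAt (𝓡∂ 2) p).symm) (range (𝓡∂ 2))
        (extChartAt (𝓡∂ 2) p p)).toLinearMap (LinearMap.ker_eq_bot.2 hinj)
    convert! this using 2
    simp [partialDeriv, localRep]
  exact Matrix.posDef_gram_of_linearIndependent hlin

theorem hessian_quad_comp [IsManifold (𝓡∂ 2) ∞ M]
    (hf : ContMDiff (𝓡∂ 2) 𝓘(ℝ, E3) ∞ f) (p : M) (b : E3) (e m : ℝ)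
    (i j : Fin 2) :
    fderivWithin ℝ (fun z => fderivWithin ℝ (fun z => quad b e m (localRep f p z))
        (range (𝓡∂ 2)) z (EuclideanSpace.single j 1)) (range (𝓡∂ 2)) (extChartAt (𝓡∂ 2) p p)
        (EuclideanSpace.single i 1)
      = ⟪b - (2 * m) • f p, partialDeriv₂ f p i j (extChartAt (𝓡∂ 2) p p)⟫_ℝ
        - 2 * m * firstFundamentalForm f p i j := by
  have h := fderivWithin_fderivWithin_quad_comp b e m (𝓡∂ 2).uniqueDiffOn
    ((contDiffWithinAt_comp_extChartAt_symm hf p (mem_extChartAt_target p)).of_le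
      ENat.LEInfty.out)
    (mem_range_self _) (EuclideanSpace.single i 1) (EuclideanSpace.single j 1)
  rwa [show (f ∘ (extChartAt (𝓡∂ 2) p).symm) (extChartAt (𝓡∂ 2) p p) = f p from
    localRep_extChartAt f p] at h

theorem isUnitNormal_iff (hf : ContMDiff (𝓡∂ 2) 𝓘(ℝ, E3) ∞ f) (p : M) (ν : E3) :
    IsUnitNormal f p ν ↔ ‖ν‖ = 1 ∧ ∀ v, ⟪ν, chartDeriv f p v⟫_ℝ = 0 := by
  rw [IsUnitNormal, mfderiv_eq_fderivWithin hf]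
  rfl

theorem inner_chartDeriv_eq_fderivWithin_quad [IsManifold (𝓡∂ 2) ∞ M]
    (hf : ContMDiff (𝓡∂ 2) 𝓘(ℝ, E3) ∞ f) (p : M) (b : E3) (e m : ℝ)
    (v : EuclideanSpace ℝ (Fin 2)) :
    ⟪b - (2 * m) • f p, chartDeriv f p v⟫_ℝ
      = fderivWithin ℝ (fun z => quad b e m (localRep f p z)) (range (𝓡∂ 2))
        (extChartAt (𝓡∂ 2) p p) v := by
  have h := fderivWithin_quad_comp (y := extChartAt (𝓡∂ 2) p p) b e m
    ((𝓡∂ 2).uniqueDiffOn _ (mem_range_self _))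
    ((contDiffWithinAt_comp_extChartAt_symm hf p (mem_extChartAt_target p)).differentiableWithinAt
      (by simp)) v
  rw [show (f ∘ (extChartAt (𝓡∂ 2) p).symm) (extChartAt (𝓡∂ 2) p p) = f p from
    localRep_extChartAt f p] at h
  exact h.symm

/-- The coordinate Hessian carries no Christoffel correction; none is needed at a critical point on
the surface, where the ambient gradient b - 2m f(p) is normal and so of the form aν. The value a = 0
covers a vanishing gradient. -/
theorem trace_inv_mul_hessian [IsManifold (𝓡∂ 2) ∞ M] (hf : ContMDiff (𝓡∂ 2) 𝓘(ℝ, E3) ∞ f)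
    {p : M} (hinj : Function.Injective (mfderiv (𝓡∂ 2) 𝓘(ℝ, E3) f p)) {b ν : E3} {a m : ℝ}
    (hν : b - (2 * m) • f p = a • ν) (e : ℝ) :
    ((firstFundamentalForm f p)⁻¹ * Matrix.of fun i j =>
      fderivWithin ℝ (fun z => fderivWithin ℝ (fun z => quad b e m (localRep f p z))
        (range (𝓡∂ 2)) z (EuclideanSpace.single j 1)) (range (𝓡∂ 2)) (extChartAt (𝓡∂ 2) p p)
        (EuclideanSpace.single i 1)).trace = a * meanCurvature f p ν - 4 * m := by
  refine trace_inv_mul_of_eq (firstFundamentalForm_posDef hf hinj) ?_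
  ext i j
  simp only [Matrix.of_apply, hessian_quad_comp hf, hν, Matrix.sub_apply, Matrix.smul_apply,
    secondFundamentalForm, real_inner_smul_left, smul_eq_mul]
  rw [real_inner_comm]

theorem hessian_nonpos_of_isLocalMax [IsManifold (𝓡∂ 2) ∞ M] (hf : ContMDiff (𝓡∂ 2) 𝓘(ℝ, E3) ∞ f)
    {p : M} (hp : (𝓡∂ 2).IsInteriorPoint p) {b : E3} {e m : ℝ}
    (hmax : IsLocalMax (fun q => quad b e m (f q)) p) :
    fderivWithin ℝ (fun z => quad b e m (localRep f p z)) (range (𝓡∂ 2))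
        (extChartAt (𝓡∂ 2) p p) = 0 ∧ ∀ v : Fin 2 → ℝ, v ⬝ᵥ (Matrix.of fun i j =>
      fderivWithin ℝ (fun z => fderivWithin ℝ (fun z => quad b e m (localRep f p z))
        (range (𝓡∂ 2)) z (EuclideanSpace.single j 1)) (range (𝓡∂ 2)) (extChartAt (𝓡∂ 2) p p)
        (EuclideanSpace.single i 1)).mulVec v ≤ 0 := by
  set x := extChartAt (𝓡∂ 2) p p with hx
  set w : EuclideanSpace ℝ (Fin 2) → ℝ := fun z => quad b e m (localRep f p z) with hw
  have hs : range (𝓡∂ 2) ∈ nhds x := range_mem_nhds_isInteriorPoint hp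
  have hwsm : ContDiffAt ℝ 2 w x :=
    (contDiff_quad b e m).contDiffAt.comp x
      (((contDiffWithinAt_comp_extChartAt_symm hf p (mem_extChartAt_target p)).of_le
        ENat.LEInfty.out).contDiffAt hs)
  have hwmax : IsLocalMax w x := by
    have h1 : Filter.Tendsto (extChartAt (𝓡∂ 2) p).symm (nhds x) (nhds p) := by
      have := continuousAt_extChartAt_symm (I := 𝓡∂ 2) p
      rwa [ContinuousAt, extChartAt_to_inv] at this
    filter_upwards [h1.eventually hmax] with z hz
    have h2 : w x = quad b e m (f p) := by rw [hw, hx]; simp only [localRep_extChartAt]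
    exact hz.trans_eq h2.symm
  refine ⟨by rw [fderivWithin_of_mem_nhds hs, hwmax.fderiv_eq_zero], fun v => ?_⟩
  have hev : ∀ᶠ z in nhds x, fderivWithin ℝ w (range (𝓡∂ 2)) z = fderiv ℝ w z := by
    filter_upwards [eventually_mem_nhds_iff.2 hs] with z hz using fderivWithin_of_mem_nhds hz
  have hd : DifferentiableAt ℝ (fderiv ℝ w) x :=
    (hwsm.fderiv_right (m := 1) (by norm_num)).differentiableAt (by norm_num)
  have h2 : ∀ u v : EuclideanSpace ℝ (Fin 2),
      fderiv ℝ (fun z => fderiv ℝ w z v) x u = fderiv ℝ (fderiv ℝ w) x u v := fun u v => by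
    rw [fderiv_clm_apply hd (differentiableAt_const v)]
    simp
  have h3 : ∀ u v : EuclideanSpace ℝ (Fin 2),
      fderivWithin ℝ (fun z => fderivWithin ℝ w (range (𝓡∂ 2)) z v) (range (𝓡∂ 2)) x u
        = fderiv ℝ (fderiv ℝ w) x u v := fun u v => by
    rw [fderivWithin_of_mem_nhds hs, ← h2]
    congr 1
    exact Filter.EventuallyEq.fderiv_eq (by filter_upwards [hev] with z hz; rw [hz])
  have h4 := fderiv_fderiv_nonpos_of_isLocalMax hwmax hwsm
    (v 0 • EuclideanSpace.single 0 1 + v 1 • EuclideanSpace.single 1 1)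
  rw [h2] at h4
  simp only [h3]
  simp [dotProduct, Matrix.mulVec, Fin.sum_univ_two] at h4 ⊢
  linarith

/-- The maximum principle for `-4`-stationary surfaces: a quadratic function
`⟨b, x⟩ + e - m |x|²` that vanishes at an interior local maximum has `e ≤ 0`. -/
theorem IsStationary.nonpos_of_isLocalMax [IsManifold (𝓡∂ 2) ∞ M] (hf : IsStationary (-4) f)
    {p : M} (hp : (𝓡∂ 2).IsInteriorPoint p) {b : E3} {e m : ℝ} (h0 : quad b e m (f p) = 0)
    (hmax : IsLocalMax (fun q => quad b e m (f q)) p) : e ≤ 0 := by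
  obtain ⟨hd, hH⟩ := hessian_nonpos_of_isLocalMax hf.smooth hp hmax
  have htr := trace_inv_mul_nonpos (firstFundamentalForm_posDef hf.smooth (hf.immersion p)) hH
  have hpos : 0 < ⟪f p, f p⟫_ℝ := real_inner_self_pos.2 (hf.ne_zero p)
  unfold quad at h0
  by_cases hN : b - (2 * m) • f p = 0
  -- If the ambient gradient vanishes, the trace is -4m ≤ 0, while `h0` gives e = -m|f|².
  · rw [trace_inv_mul_hessian hf.smooth (hf.immersion p) (a := 0) (ν := 0) (by simp [hN])] at htr
    have : b = (2 * m) • f p := sub_eq_zero.1 hN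
    rw [this, real_inner_smul_left] at h0
    nlinarith
  · set N := b - (2 * m) • f p with hNdef
    have hN' : 0 < ‖N‖ := norm_pos_iff.2 hN
    have hν : IsUnitNormal f p (‖N‖⁻¹ • N) := by
      refine (isUnitNormal_iff hf.smooth p _).2 ⟨norm_smul_inv_norm hN, fun v => ?_⟩
      rw [real_inner_smul_left, inner_chartDeriv_eq_fderivWithin_quad hf.smooth p b e m v, hd]
      simp
    have ha : N = ‖N‖ • (‖N‖⁻¹ • N) := by rw [smul_smul, mul_inv_cancel₀ hN'.ne', one_smul]
    rw [trace_inv_mul_hessian hf.smooth (hf.immersion p) ha, hf.meanCurvature_eq p _ hν,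
      real_inner_smul_left, ← real_inner_self_eq_norm_sq, hNdef, inner_sub_left,
      real_inner_smul_left, ← hNdef] at htr
    -- Since ⟨N,f⟩ = -m|f|² - e, the factor -4 makes the terms in m cancel exactly.
    have h5 : ‖N‖ * (-4 * (‖N‖⁻¹ * (⟪b, f p⟫_ℝ - 2 * m * ⟪f p, f p⟫_ℝ)) / ⟪f p, f p⟫_ℝ) - 4 * m
        = 4 * e / ⟪f p, f p⟫_ℝ := by
      have : ⟪b, f p⟫_ℝ = m * ⟪f p, f p⟫_ℝ - e := by linarith
      rw [this]
      field_simp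
      ring
    rw [h5] at htr
    by_contra! he
    exact absurd htr (not_le.2 (by positivity))

/-- An immersed surface in a plane through the origin or a sphere through the origin is
`-4`-stationary. -/
theorem isStationary_of_inner_eq [IsManifold (𝓡∂ 2) ∞ M] (hf : ContMDiff (𝓡∂ 2) 𝓘(ℝ, E3) ∞ f)
    (hinj : ∀ p, Function.Injective (mfderiv (𝓡∂ 2) 𝓘(ℝ, E3) f p)) (hne : ∀ p, f p ≠ 0)
    {b : E3} (hb : b ≠ 0) {t : ℝ} (hS : ∀ p, ⟪b, f p⟫_ℝ = t * ⟪f p, f p⟫_ℝ) :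
    IsStationary (-4) f ∧ (∀ p, b - (2 * t) • f p ≠ 0) ∧
      ∀ p, IsUnitNormal f p (‖b - (2 * t) • f p‖⁻¹ • (b - (2 * t) • f p)) := by
  have hN : ∀ p, b - (2 * t) • f p ≠ 0 := fun p h => by
    have h1 : b = (2 * t) • f p := sub_eq_zero.1 h
    have h2 := hS p
    rw [h1, real_inner_smul_left] at h2
    have hpos : 0 < ⟪f p, f p⟫_ℝ := real_inner_self_pos.2 (hne p)
    have ht : t = 0 := by
      have : t * ⟪f p, f p⟫_ℝ = 0 := by linarith
      exact (mul_eq_zero.1 this).resolve_right hpos.ne'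
    exact hb (by rw [h1, ht]; simp)
  have hquad : ∀ p, (fun z => quad b 0 t (localRep f p z)) = fun _ => 0 := fun p => by
    funext z
    simp [quad, localRep, hS]
  have horth : ∀ p v, ⟪b - (2 * t) • f p, chartDeriv f p v⟫_ℝ = 0 := fun p v => by
    rw [inner_chartDeriv_eq_fderivWithin_quad hf p b 0 t v, hquad]
    simp
  refine ⟨⟨hf, hinj, hne, fun p ν hν => ?_⟩, hN, fun p =>
    (isUnitNormal_iff hf p _).2 ⟨norm_smul_inv_norm (hN p), fun v => ?_⟩⟩
  -- The normal space of the immersion is a line, so the gradient is a multiple of whichever unit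
  -- normal is given.
  · obtain ⟨a, ha⟩ : ∃ a : ℝ, b - (2 * t) • f p = a • ν := by
      let A : EuclideanSpace ℝ (Fin 2) →ₗ[ℝ] E3 := (chartDeriv f p).toLinearMap
      have hA : Module.finrank ℝ (LinearMap.range A) = 2 := by
        rw [LinearMap.finrank_range_of_inj (show Function.Injective A from
          (injective_mfderiv_iff hf p).1 (hinj p))]
        simp
      have hA' : Module.finrank ℝ (LinearMap.range A)ᗮ = 1 := by
        have := (LinearMap.range A).finrank_add_finrank_orthogonal
        rw [hA] at this
        simp at this
        omega
      have hm : ∀ x : E3, (∀ v, ⟪x, chartDeriv f p v⟫_ℝ = 0) →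
          x ∈ (LinearMap.range A)ᗮ := by
        rintro x hx
        rw [Submodule.mem_orthogonal']
        rintro _ ⟨v, rfl⟩
        exact hx v
      have hν0 : (⟨ν, hm ν ((isUnitNormal_iff hf p ν).1 hν).2⟩ : (LinearMap.range A)ᗮ) ≠ 0 := by
        intro h
        have : ν = 0 := congrArg Subtype.val h
        simpa [this] using hν.1
      obtain ⟨a, ha⟩ := (finrank_eq_one_iff_of_nonzero' _ hν0).1 hA' ⟨_, hm _ (horth p)⟩
      exact ⟨a, (congrArg Subtype.val ha).symm⟩
    have ha0 : a ≠ 0 := by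
      rintro rfl
      exact hN p (by simpa using ha)
    -- The quadratic function is identically zero on the surface, so the trace formula becomes aH =
    -- 4t; on the other hand a⟨ν,f⟩ = -t|f|².
    have htr := trace_inv_mul_hessian hf (hinj p) ha 0
    rw [hquad] at htr
    simp only [fderivWithin_fun_const, Pi.zero_apply, zero_apply] at htr
    have h0 : (Matrix.of fun _ _ : Fin 2 => (0 : ℝ)) = 0 := rfl
    rw [h0, mul_zero, Matrix.trace_zero] at htr
    have h1 : a * ⟪ν, f p⟫_ℝ = -(t * ⟪f p, f p⟫_ℝ) := by
      rw [← real_inner_smul_left, ← ha, inner_sub_left, real_inner_smul_left, hS]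
      ring
    have hpos : 0 < ⟪f p, f p⟫_ℝ := real_inner_self_pos.2 (hne p)
    rw [← real_inner_self_eq_norm_sq, eq_div_iff hpos.ne']
    refine mul_left_cancel₀ ha0 ?_
    linear_combination -⟪f p, f p⟫_ℝ * htr + 4 * h1
  · rw [real_inner_smul_left, horth, mul_zero]

end Charts

/-! ### Local homeomorphisms onto the closed unit disc -/

theorem subset_of_isPreconnected_of_forall_mem_nhds {X : Type*} [TopologicalSpace X] {s Z : Set X}
    (hs : IsPreconnected s) (hZ : IsClosed Z) (hne : (s ∩ Z).Nonempty)
    (h : ∀ y ∈ s ∩ Z, Z ∈ nhds y) : s ⊆ Z := by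
  refine (hs.subset_of_closure_inter_subset isOpen_interior ?_ ?_).trans interior_subset
  · obtain ⟨y, hy⟩ := hne
    exact ⟨y, hy.1, mem_interior_iff_mem_nhds.2 (h y hy)⟩
  · rintro y ⟨hy, hys⟩
    exact mem_interior_iff_mem_nhds.2
      (h y ⟨hys, closure_minimal interior_subset hZ hy⟩)

section Disc

variable {E : Type*} [NormedAddCommGroup E] [NormedSpace ℝ E]
  {M : Type*} [TopologicalSpace M] [CompactSpace M] {h : M → E} {B : Set M}

/-- The range is a neighbourhood of each of its points off the unit sphere. Hence a point of maximal
norm cannot have norm above 1, as it could be pushed outward, and the range is clopen in the open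
ball. The condition `hdense` supplies a point of the range inside the open ball. -/
theorem range_eq_closedBall [Nonempty M] (hc : Continuous h) (hB : h '' B = Metric.sphere 0 1)
    (hint : ∀ p ∉ B, ∀ N ∈ nhds p, h '' N ∈ nhds (h p))
    (hdense : ∀ p, ∀ N ∈ nhds p, ∃ q ∈ N, h '' N ∈ nhds (h q)) :
    range h = Metric.closedBall 0 1 := by
  have hcl : IsClosed (range h) := (isCompact_range hc).isClosed
  have hmem : ∀ p, ‖h p‖ ≠ 1 → range h ∈ nhds (h p) := fun p hp => by
    rw [← image_univ]
    refine hint p (fun hpB => hp ?_) univ Filter.univ_mem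
    have : h p ∈ Metric.sphere (0 : E) 1 := hB ▸ mem_image_of_mem h hpB
    simpa using this
  have hle : range h ⊆ Metric.closedBall 0 1 := by
    obtain ⟨p, -, hp⟩ := isCompact_univ.exists_isMaxOn univ_nonempty (hc.norm.continuousOn)
    have hp1 : ‖h p‖ ≤ 1 := by
      by_contra! hp1
      have h1 : Filter.Tendsto (fun t : ℝ => t • h p) (nhds 1) (nhds (h p)) := by
        have : Continuous fun t : ℝ => t • h p := by fun_prop
        simpa using this.tendsto 1
      have h2 : ∀ᶠ t : ℝ in nhds 1, t • h p ∈ range h := h1 (hmem p hp1.ne')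
      have h3 : ∀ᶠ t : ℝ in nhdsWithin 1 (Ioi 1), t • h p ∈ range h ∧ 1 < t :=
        (h2.filter_mono nhdsWithin_le_nhds).and self_mem_nhdsWithin
      obtain ⟨t, ⟨q, hq⟩, ht⟩ := h3.exists
      have h4 : ‖h q‖ ≤ ‖h p‖ := hp (mem_univ q)
      rw [hq, norm_smul, Real.norm_of_nonneg (by linarith)] at h4
      nlinarith
    rintro _ ⟨q, rfl⟩
    simpa using (hp (mem_univ q)).trans hp1
  refine hle.antisymm ?_
  rw [← closure_ball (0 : E) one_ne_zero]
  refine closure_minimal ?_ hcl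
  refine subset_of_isPreconnected_of_forall_mem_nhds (convex_ball (0 : E) 1).isPreconnected hcl ?_ ?_
  · obtain ⟨q, -, hq⟩ := hdense (Classical.arbitrary M) univ Filter.univ_mem
    rw [image_univ] at hq
    refine ⟨h q, ?_, mem_range_self q⟩
    rw [← interior_closedBall (0 : E) one_ne_zero]
    exact mem_interior_iff_mem_nhds.2 (Filter.mem_of_superset hq hle)
  · rintro _ ⟨hy, p, rfl⟩
    exact hmem p (by simpa using (mem_ball_zero_iff.1 hy).ne)

/-- The content is at points over the unit sphere. On a compact neighbourhood K where h is
injective, the image of the frontier of K misses a ball around h(p). That ball meets the open unit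
ball in a convex, hence connected, set, in which h(K) is clopen and nonempty; taking closures gives
the relative neighbourhood. -/
theorem image_mem_nhdsWithin_closedBall [T2Space M] [Nonempty M] (hc : Continuous h)
    (hB : h '' B = Metric.sphere 0 1) (hinj : ∀ p, ∃ N ∈ nhds p, InjOn h N)
    (hint : ∀ p ∉ B, ∀ N ∈ nhds p, h '' N ∈ nhds (h p))
    (hdense : ∀ p, ∀ N ∈ nhds p, ∃ q ∈ N, h '' N ∈ nhds (h q)) (p : M) {N : Set M}
    (hN : N ∈ nhds p) : h '' N ∈ nhdsWithin (h p) (Metric.closedBall 0 1) := by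
  have hrange := range_eq_closedBall hc hB hint hdense
  obtain ⟨N', hN', hinj'⟩ := hinj p
  obtain ⟨K, ⟨hKp, hK⟩, hKN⟩ :=
    (compact_basis_nhds p).mem_iff.1 (Filter.inter_mem hN hN')
  have hKc : IsClosed (h '' K) := (hK.image hc).isClosed
  have hC : (h '' (K \ interior K))ᶜ ∈ nhds (h p) := by
    refine ((hK.diff isOpen_interior).image hc).isClosed.isOpen_compl.mem_nhds ?_
    rintro ⟨z, hz, hzp⟩
    have : z = p := hinj' (hKN hz.1).2 (hKN (mem_of_mem_nhds hKp)).2 hzp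
    exact hz.2 (this ▸ mem_interior_iff_mem_nhds.2 hKp)
  obtain ⟨ε, hε, hεC⟩ := Metric.mem_nhds_iff.1 hC
  have hsub : Metric.ball (h p) ε ∩ Metric.ball 0 1 ⊆ h '' K := by
    refine subset_of_isPreconnected_of_forall_mem_nhds
      ((convex_ball (h p) ε).inter (convex_ball 0 1)).isPreconnected hKc ?_ ?_
    · obtain ⟨q, hq, hqn⟩ := hdense p (h ⁻¹' Metric.ball (h p) ε ∩ K)
        (Filter.inter_mem (hc.continuousAt.preimage_mem_nhds (Metric.ball_mem_nhds _ hε)) hKp)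
      refine ⟨h q, ⟨hq.1, ?_⟩, mem_image_of_mem h hq.2⟩
      rw [← interior_closedBall (0 : E) one_ne_zero]
      exact mem_interior_iff_mem_nhds.2
        (Filter.mem_of_superset hqn ((image_subset_range _ _).trans hrange.subset))
    · rintro _ ⟨⟨hy, hy1⟩, z, hz, rfl⟩
      have hzi : z ∈ interior K := by
        by_contra hzi
        exact hεC hy (mem_image_of_mem h ⟨hz, hzi⟩)
      refine hint z (fun hzB => ?_) K (mem_interior_iff_mem_nhds.1 hzi)
      have h1 : h z ∈ Metric.sphere (0 : E) 1 := hB ▸ mem_image_of_mem h hzB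
      exact (mem_ball_zero_iff.1 hy1).ne (mem_sphere_zero_iff_norm.1 h1)
  refine mem_nhdsWithin.2 ⟨Metric.ball (h p) ε, Metric.isOpen_ball, Metric.mem_ball_self hε, ?_⟩
  rw [← closure_ball (0 : E) one_ne_zero]
  exact (Metric.isOpen_ball.inter_closure.trans (closure_minimal hsub hKc)).trans
    (image_mono fun z hz => (hKN hz).1)

/-- Corestricted to the closed ball, h is an open local homeomorphism from a compact space, hence a
covering. The ball is simply connected, so a section passes through any given p; by uniqueness of
lifts on the connected M, the section is a left inverse of the covering. -/
theorem injective_of_locally_injective [T2Space M] [ConnectedSpace M] (hc : Continuous h)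
    (hB : h '' B = Metric.sphere 0 1) (hinj : ∀ p, ∃ N ∈ nhds p, InjOn h N)
    (hint : ∀ p ∉ B, ∀ N ∈ nhds p, h '' N ∈ nhds (h p))
    (hdense : ∀ p, ∀ N ∈ nhds p, ∃ q ∈ N, h '' N ∈ nhds (h q)) : Function.Injective h := by
  have hrange := range_eq_closedBall hc hB hint hdense
  have hmem : ∀ p, h p ∈ Metric.closedBall (0 : E) 1 := fun p => hrange ▸ mem_range_self p
  let k : M → Metric.closedBall (0 : E) 1 := fun p => ⟨h p, hmem p⟩
  have hk : Continuous k := hc.subtype_mk hmem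
  have hopen : IsOpenMap k := by
    refine IsOpenMap.of_nhds_le fun p s hs => ?_
    have h1 := image_mem_nhdsWithin_closedBall hc hB hinj hint hdense p (N := k ⁻¹' s) hs
    rw [mem_nhdsWithin_iff_exists_mem_nhds_inter] at h1
    obtain ⟨u, hu, hus⟩ := h1
    refine mem_nhds_subtype _ _ _ |>.2 ⟨u, hu, ?_⟩
    intro y hy
    obtain ⟨z, hz, hzy⟩ := hus ⟨hy, y.2⟩
    have : k z = y := Subtype.ext hzy
    exact this ▸ hz
  have hloc : IsLocalHomeomorph k := by
    rw [isLocalHomeomorph_iff_isOpenEmbedding_restrict]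
    intro p
    obtain ⟨N, hN, hNi⟩ := hinj p
    refine ⟨interior N, interior_mem_nhds.2 hN, ?_⟩
    refine Topology.IsOpenEmbedding.of_continuous_injective_isOpenMap
      (hk.comp continuous_subtype_val) ?_ (hopen.domRestrict isOpen_interior)
    intro x y hxy
    exact Subtype.ext (hNi (interior_subset x.2) (interior_subset y.2)
      (congrArg Subtype.val hxy))
  have hcov : IsCoveringMap k := isLocalHomeomorph_iff_isCoveringMap.1 hloc
  have hconv : Convex ℝ (Metric.closedBall (0 : E) 1) := convex_closedBall 0 1
  have : ContractibleSpace (Metric.closedBall (0 : E) 1) :=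
    hconv.contractibleSpace ⟨0, by simp⟩
  have := hconv.locallyPathConnectedSpace
  have key : ∀ p q, k p = k q → p = q := by
    intro p q hpq
    obtain ⟨F, ⟨hF0, hF⟩, -⟩ := hcov.existsUnique_continuousMap_lifts
      (ContinuousMap.id _) (k p) p rfl
    have hFk : ∀ z, F (k z) = z := by
      have := hcov.eq_of_comp_eq (F.continuous.comp hk) continuous_id
        (by funext z; exact congrFun hF (k z)) p hF0
      exact fun z => congrFun this z
    rw [← hFk p, hpq, hFk q]
  exact fun p q hpq => key p q (Subtype.ext hpq)

end Disc

/-! ### Immersions of a surface with boundary into the plane -/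

section Plane

variable {M : Type*} [TopologicalSpace M] [ChartedSpace (EuclideanHalfSpace 2) M]
  [IsManifold (𝓡∂ 2) ∞ M] {h : M → EuclideanSpace ℝ (Fin 2)}

/-- A ball intersected with the half-plane is convex, so continuity of the one-sided derivative up
to the boundary yields uniform linear approximation by the mean value inequality. The bound c <
‖A⁻¹‖⁻¹ is the threshold for injectivity and, at interior points, openness. -/
theorem exists_approximatesLinearOn
    (hh : ContMDiff (𝓡∂ 2) 𝓘(ℝ, EuclideanSpace ℝ (Fin 2)) ∞ h) {p : M}
    (hinj : Function.Injective (chartDeriv h p)) :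
    ∃ (A : EuclideanSpace ℝ (Fin 2) ≃L[ℝ] EuclideanSpace ℝ (Fin 2)) (c : NNReal) (δ : ℝ),
      c < ‖(A.symm : EuclideanSpace ℝ (Fin 2) →L[ℝ] EuclideanSpace ℝ (Fin 2))‖₊⁻¹ ∧ 0 < δ ∧
      Metric.ball (extChartAt (𝓡∂ 2) p p) δ ∩ range (𝓡∂ 2) ⊆ (extChartAt (𝓡∂ 2) p).target ∧
      ApproximatesLinearOn (h ∘ (extChartAt (𝓡∂ 2) p).symm)
        (A : EuclideanSpace ℝ (Fin 2) →L[ℝ] EuclideanSpace ℝ (Fin 2))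
        (Metric.ball (extChartAt (𝓡∂ 2) p p) δ ∩ range (𝓡∂ 2)) c := by
  let A : EuclideanSpace ℝ (Fin 2) ≃L[ℝ] EuclideanSpace ℝ (Fin 2) :=
    (LinearEquiv.ofInjectiveEndo (chartDeriv h p).toLinearMap hinj).toContinuousLinearEquiv
  have hA : (A : EuclideanSpace ℝ (Fin 2) →L[ℝ] EuclideanSpace ℝ (Fin 2)) = chartDeriv h p := by
    ext v
    rfl
  have hpos : 0 < ‖(A.symm : EuclideanSpace ℝ (Fin 2) →L[ℝ] EuclideanSpace ℝ (Fin 2))‖₊⁻¹ :=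
    inv_pos.2 (A.subsingleton_or_nnnorm_symm_pos.resolve_left (not_subsingleton _))
  obtain ⟨c, hc0, hc⟩ := exists_between hpos
  have hcont := ((contDiffWithinAt_comp_extChartAt_symm hh p
    (mem_extChartAt_target p)).fderivWithin_right (m := 0) (𝓡∂ 2).uniqueDiffOn (by simp)
    (mem_range_self _)).continuousWithinAt
  have hev : ∀ᶠ y in nhdsWithin (extChartAt (𝓡∂ 2) p p) (range (𝓡∂ 2)),
      y ∈ (extChartAt (𝓡∂ 2) p).target ∧
      ‖fderivWithin ℝ (h ∘ (extChartAt (𝓡∂ 2) p).symm) (range (𝓡∂ 2)) y - chartDeriv h p‖ ≤ c := by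
    refine Filter.Eventually.and (extChartAt_target_mem_nhdsWithin p) ?_
    filter_upwards [hcont.eventually (Metric.closedBall_mem_nhds _ (NNReal.coe_pos.2 hc0))]
      with y hy
    exact mem_closedBall_iff_norm.1 hy
  obtain ⟨δ, hδ, hδs⟩ := Metric.mem_nhdsWithin_iff.1 hev
  refine ⟨A, c, δ, hc, hδ, fun y hy => (hδs hy).1, fun x hx y hy => ?_⟩
  rw [hA]
  refine ((convex_ball _ δ).inter (𝓡∂ 2).convex_range).norm_image_sub_le_of_norm_hasFDerivWithin_le'
    (fun z hz => ?_) (fun z hz => (hδs hz).2) hy hx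
  exact (((contDiffWithinAt_comp_extChartAt_symm hh p (hδs hz).1).differentiableWithinAt
    (by simp)).hasFDerivWithinAt).mono inter_subset_right

theorem exists_injOn_nhds
    (hh : ContMDiff (𝓡∂ 2) 𝓘(ℝ, EuclideanSpace ℝ (Fin 2)) ∞ h) {p : M}
    (hinj : Function.Injective (chartDeriv h p)) : ∃ N ∈ nhds p, InjOn h N := by
  obtain ⟨A, c, δ, hc, hδ, -, happ⟩ := exists_approximatesLinearOn hh hinj
  refine ⟨(extChartAt (𝓡∂ 2) p).source ∩
    extChartAt (𝓡∂ 2) p ⁻¹' Metric.ball (extChartAt (𝓡∂ 2) p p) δ,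
    Filter.inter_mem (extChartAt_source_mem_nhds p)
      ((continuousAt_extChartAt p).preimage_mem_nhds (Metric.ball_mem_nhds _ hδ)), ?_⟩
  rintro x ⟨hx, hxδ⟩ y ⟨hy, hyδ⟩ hxy
  refine (extChartAt (𝓡∂ 2) p).injOn hx hy (happ.injOn (.inr hc)
    ⟨hxδ, extChartAt_target_subset_range p ((extChartAt (𝓡∂ 2) p).map_source hx)⟩
    ⟨hyδ, extChartAt_target_subset_range p ((extChartAt (𝓡∂ 2) p).map_source hy)⟩ ?_)
  rwa [Function.comp_apply, Function.comp_apply, (extChartAt (𝓡∂ 2) p).left_inv hx,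
    (extChartAt (𝓡∂ 2) p).left_inv hy]

/-- One δ serves all interior chart points y near p, even when p is a boundary point. Taking y at
the centre gives openness at interior points; taking y nearby gives the density condition at
boundary points. -/
theorem exists_image_mem_nhds
    (hh : ContMDiff (𝓡∂ 2) 𝓘(ℝ, EuclideanSpace ℝ (Fin 2)) ∞ h) {p : M}
    (hinj : Function.Injective (chartDeriv h p)) :
    ∃ δ > 0, Metric.ball (extChartAt (𝓡∂ 2) p p) δ ∩ range (𝓡∂ 2) ⊆ (extChartAt (𝓡∂ 2) p).target ∧
      ∀ y ∈ Metric.ball (extChartAt (𝓡∂ 2) p p) δ ∩ interior (range (𝓡∂ 2)),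
        ∀ N ∈ nhds ((extChartAt (𝓡∂ 2) p).symm y),
          h '' N ∈ nhds (h ((extChartAt (𝓡∂ 2) p).symm y)) := by
  obtain ⟨A, c, δ, hc, hδ, hT, happ⟩ := exists_approximatesLinearOn hh hinj
  refine ⟨δ, hδ, hT, fun y hy N hN => ?_⟩
  have hsub := inter_subset_inter_right (Metric.ball (extChartAt (𝓡∂ 2) p p) δ)
    (interior_subset (s := range (𝓡∂ 2)))
  have hmap := (happ.mono_set hsub).map_nhds_eq A.toNonlinearRightInverse
    ((Metric.isOpen_ball.inter isOpen_interior).mem_nhds hy) (.inr hc)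
  have hcont : ContinuousAt (extChartAt (𝓡∂ 2) p).symm y := by
    refine (continuousOn_extChartAt_symm p y (hT (hsub hy))).continuousAt ?_
    exact Filter.mem_of_superset ((Metric.isOpen_ball.inter isOpen_interior).mem_nhds hy)
      (hsub.trans hT)
  have h1 := Filter.image_mem_map (m := h ∘ (extChartAt (𝓡∂ 2) p).symm)
    (hcont.preimage_mem_nhds hN)
  rw [hmap, image_comp] at h1
  exact Filter.mem_of_superset h1 (image_mono (image_preimage_subset _ _))

/-- A smooth immersion into the plane of a compact connected surface that maps the boundary onto
the unit circle is injective, and its image is the closed unit disc. -/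
theorem injective_and_range_eq_closedBall [T2Space M] [CompactSpace M] [ConnectedSpace M]
    (hh : ContMDiff (𝓡∂ 2) 𝓘(ℝ, EuclideanSpace ℝ (Fin 2)) ∞ h)
    (hinj : ∀ p, Function.Injective (chartDeriv h p))
    (hB : h '' (𝓡∂ 2).boundary M = Metric.sphere 0 1) :
    Function.Injective h ∧ range h = Metric.closedBall 0 1 := by
  have hint : ∀ p ∉ (𝓡∂ 2).boundary M, ∀ N ∈ nhds p, h '' N ∈ nhds (h p) := fun p hp N hN => by
    obtain ⟨δ, hδ, -, H⟩ := exists_image_mem_nhds hh (hinj p)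
    have hpi : (𝓡∂ 2).IsInteriorPoint p :=
      ((𝓡∂ 2).isInteriorPoint_iff_not_isBoundaryPoint p).2 hp
    simpa only [extChartAt_to_inv] using H (extChartAt (𝓡∂ 2) p p)
      ⟨Metric.mem_ball_self hδ, hpi⟩ N
      (by rwa [extChartAt_to_inv])
  have hdense : ∀ p, ∀ N ∈ nhds p, ∃ q ∈ N, h '' N ∈ nhds (h q) := fun p N hN => by
    obtain ⟨δ, hδ, hT, H⟩ := exists_image_mem_nhds hh (hinj p)
    have hx : extChartAt (𝓡∂ 2) p p ∈ closure (interior (range (𝓡∂ 2))) :=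
      (𝓡∂ 2).range_subset_closure_interior (mem_range_self _)
    have hN' : (extChartAt (𝓡∂ 2) p).symm ⁻¹' interior N ∈ nhds (extChartAt (𝓡∂ 2) p p) :=
      (continuousAt_extChartAt_symm p).preimage_mem_nhds
        (by rw [extChartAt_to_inv]; exact interior_mem_nhds.2 hN)
    obtain ⟨y, ⟨hyN, hyδ⟩, hy⟩ := mem_closure_iff_nhds.1 hx _
      (Filter.inter_mem hN' (Metric.ball_mem_nhds _ hδ))
    exact ⟨_, interior_subset hyN, H y ⟨hyδ, hy⟩ N (mem_interior_iff_mem_nhds.1 hyN)⟩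
  exact ⟨injective_of_locally_injective hh.continuous hB (fun p => exists_injOn_nhds hh (hinj p))
    hint hdense, range_eq_closedBall hh.continuous hB hint hdense⟩

end Plane

/-! ### Discs in planes and caps of spheres through the origin -/

theorem norm_sub_eq_norm_iff (x a : E3) : ‖x - a‖ = ‖a‖ ↔ ⟪x, x⟫_ℝ = 2 * ⟪a, x⟫_ℝ := by
  rw [← sq_eq_sq₀ (norm_nonneg _) (norm_nonneg _), ← real_inner_self_eq_norm_sq,
    ← real_inner_self_eq_norm_sq, real_inner_sub_sub_self, real_inner_comm a x]
  constructor <;> intro h <;> linarith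

theorem norm_sub_eq_iff (x c : E3) {r : ℝ} (hr : 0 ≤ r) :
    ‖x - c‖ = r ↔ ⟪x, x⟫_ℝ - 2 * ⟪c, x⟫_ℝ + ⟪c, c⟫_ℝ = r ^ 2 := by
  rw [← sq_eq_sq₀ (norm_nonneg _) hr, ← real_inner_self_eq_norm_sq, real_inner_sub_sub_self,
    real_inner_comm c x]

theorem norm_sub_le_iff (x c : E3) {r : ℝ} (hr : 0 ≤ r) :
    ‖x - c‖ ≤ r ↔ ⟪x, x⟫_ℝ - 2 * ⟪c, x⟫_ℝ + ⟪c, c⟫_ℝ ≤ r ^ 2 := by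
  rw [← sq_le_sq₀ (norm_nonneg _) hr, ← real_inner_self_eq_norm_sq, real_inner_sub_sub_self,
    real_inner_comm c x]

theorem IsVectorPlaneDisc.isCircle {D Γ : Set E3} (h : IsVectorPlaneDisc D Γ) : IsCircle Γ := by
  obtain ⟨c, n, r, hn, hc, hr, -, rfl⟩ := h
  exact ⟨c, n, r, hn, hr, by simp [inner_sub_right, hc]⟩

theorem IsCapOfSphereThroughOrigin.isCircle {D Γ : Set E3} (h : IsCapOfSphereThroughOrigin D Γ) :
    IsCircle Γ := by
  obtain ⟨a, n, t, -, hn, ht, -, rfl⟩ := h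
  have hnn : ⟪n, n⟫_ℝ = 1 := by rw [real_inner_self_eq_norm_sq, hn, one_pow]
  have hpos : 0 < ‖a‖ ^ 2 - (t - ⟪n, a⟫_ℝ) ^ 2 := by
    rw [sub_pos, sq_lt_sq, abs_norm]
    exact ht
  refine ⟨a + (t - ⟪n, a⟫_ℝ) • n, n, √(‖a‖ ^ 2 - (t - ⟪n, a⟫_ℝ) ^ 2), hn, Real.sqrt_pos.2 hpos, ?_⟩
  ext x
  simp only [mem_ofPred_eq]
  rw [norm_sub_eq_norm_iff, norm_sub_eq_iff _ _ (Real.sqrt_nonneg _), Real.sq_sqrt hpos.le,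
    ← real_inner_self_eq_norm_sq]
  simp only [inner_sub_right, inner_add_right, inner_add_left, real_inner_smul_left,
    real_inner_smul_right, hnn, real_inner_comm n a]
  constructor
  · rintro ⟨h1, h2⟩
    exact ⟨by linarith, by rw [h1, h2]; ring⟩
  · rintro ⟨h1, h2⟩
    have h3 : ⟪n, x⟫_ℝ = t := by linarith
    rw [h3] at h2
    exact ⟨by linarith, h3⟩

/-- If the plane of the circle misses the origin, the spheres containing the circle are centred on
its axis, and exactly one of them passes through the origin. -/
theorem IsCircle.exists_disc {Γ : Set E3} (h : IsCircle Γ) :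
    ∃ D, IsVectorPlaneDisc D Γ ∨ (IsCapOfSphereThroughOrigin D Γ ∧ 0 ∉ D) := by
  obtain ⟨c, n, r, hn, hr, rfl⟩ := h
  by_cases hm : ⟪n, c⟫_ℝ = 0
  · exact ⟨_, .inl ⟨c, n, r, hn, hm, hr, rfl, by simp [inner_sub_right, hm]⟩⟩
  -- The sign of n is chosen so that the half-space cutting out the cap excludes the origin.
  wlog hpos : 0 < ⟪n, c⟫_ℝ generalizing n
  · have := this (-n) (by rwa [norm_neg]) (by simpa using hm)
      (by rw [inner_neg_left, neg_pos]; exact lt_of_le_of_ne (not_lt.1 hpos) hm)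
    simpa using this
  set m := ⟪n, c⟫_ℝ with hmdef
  set k := ‖c‖ ^ 2 - r ^ 2 with hk
  have hnn : ⟪n, n⟫_ℝ = 1 := by rw [real_inner_self_eq_norm_sq, hn, one_pow]
  -- A centre c + sn must satisfy |c + sn|² = r² + s², i.e. 2sm = r² - |c|².
  set a := c - (k / (2 * m)) • n with ha
  have hna : m - ⟪n, a⟫_ℝ = k / (2 * m) := by
    rw [ha, inner_sub_right, real_inner_smul_right, hnn]
    ring
  have haa : ‖a‖ ^ 2 = r ^ 2 + (k / (2 * m)) ^ 2 := by
    rw [← real_inner_self_eq_norm_sq, ha, real_inner_sub_sub_self, real_inner_smul_left,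
      real_inner_smul_right, real_inner_smul_right, hnn, real_inner_comm n c, ← hmdef,
      real_inner_self_eq_norm_sq, hk]
    field_simp
    ring
  refine ⟨_, .inr ⟨⟨a, n, m, ?_, hn, ?_, rfl, ?_⟩, fun h => absurd h.2 (by simpa using hpos)⟩⟩
  · rw [← norm_pos_iff, ← sq_pos_iff (a := ‖a‖) |>.trans (norm_ne_zero_iff.trans norm_pos_iff.symm),
      haa]
    positivity
  · rw [hna, ← abs_norm a, ← sq_lt_sq, haa]
    nlinarith
  · ext x
    simp only [mem_ofPred_eq]
    rw [norm_sub_eq_norm_iff, norm_sub_eq_iff _ _ hr.le, inner_sub_right, ← hmdef, ha,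
      inner_sub_left, real_inner_smul_left, real_inner_self_eq_norm_sq c]
    constructor
    · rintro ⟨h1, h2⟩
      have h3 : ⟪n, x⟫_ℝ = m := by linarith
      refine ⟨?_, h3⟩
      rw [h3]
      field_simp
      linarith
    · rintro ⟨h1, h2⟩
      rw [h2] at h1 ⊢
      refine ⟨by ring, ?_⟩
      field_simp at h1
      linarith

/-- `Φ` parametrizes by the plane the surface `{x ≠ 0 | ⟨b, x⟩ = t |x|²}`, with inverse `Ψ`, such
that the closed unit disc is mapped onto `D` and the unit circle onto `Γ`. -/
structure IsDiscParam (D Γ : Set E3) (b : E3) (t : ℝ) (Φ : EuclideanSpace ℝ (Fin 2) → E3)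
    (Ψ : E3 → EuclideanSpace ℝ (Fin 2)) : Prop where
  ne_zero : b ≠ 0
  contDiff : ContDiff ℝ ∞ Φ
  contDiffAt_inv : ∀ x ≠ 0, ContDiffAt ℝ ∞ Ψ x
  left_inv : ∀ z, Ψ (Φ z) = z
  right_inv : ∀ x ≠ 0, ⟪b, x⟫_ℝ = t * ⟪x, x⟫_ℝ → Φ (Ψ x) = x
  inner_eq : ∀ z, ⟪b, Φ z⟫_ℝ = t * ⟪Φ z, Φ z⟫_ℝ
  image_closedBall : Φ '' Metric.closedBall 0 1 = D
  image_sphere : Φ '' Metric.sphere 0 1 = Γ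

theorem exists_linearIsometry_orthogonal {n : E3} (hn : n ≠ 0) :
    ∃ (L : EuclideanSpace ℝ (Fin 2) →ₗᵢ[ℝ] E3) (P : E3 →L[ℝ] EuclideanSpace ℝ (Fin 2)),
      (∀ z, ⟪n, L z⟫_ℝ = 0) ∧ (∀ z, P (L z) = z) ∧ ∀ y, ⟪n, y⟫_ℝ = 0 → L (P y) = y := by
  have : Fact (Module.finrank ℝ E3 = 2 + 1) := ⟨by simp⟩
  let B := OrthonormalBasis.fromOrthogonalSpanSingleton (𝕜 := ℝ) 2 hn
  let L : EuclideanSpace ℝ (Fin 2) →ₗᵢ[ℝ] E3 :=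
    (ℝ ∙ n)ᗮ.subtypeₗᵢ.comp B.repr.symm.toLinearIsometry
  have hPL : ∀ z, ContinuousLinearMap.adjoint L.toContinuousLinearMap (L z) = z := fun z => by
    refine ext_inner_left ℝ fun v => ?_
    rw [ContinuousLinearMap.adjoint_inner_right]
    exact L.inner_map_map v z
  refine ⟨L, ContinuousLinearMap.adjoint L.toContinuousLinearMap, fun z => ?_, hPL, fun y hy => ?_⟩
  · exact Submodule.mem_orthogonal_singleton_iff_inner_right.1 (B.repr.symm z).2
  · have : L (B.repr ⟨y, Submodule.mem_orthogonal_singleton_iff_inner_right.2 hy⟩) = y := by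
      simp [L]
    rw [← this, hPL]

theorem exists_affine_param {n : E3} (hn : n ≠ 0) (c : E3) {r : ℝ} (hr : 0 < r) :
    ∃ (σ : EuclideanSpace ℝ (Fin 2) → E3) (τ : E3 → EuclideanSpace ℝ (Fin 2)),
      ContDiff ℝ ∞ σ ∧ ContDiff ℝ ∞ τ ∧ (∀ z, τ (σ z) = z) ∧
      (∀ y, ⟪n, y⟫_ℝ = ⟪n, c⟫_ℝ → σ (τ y) = y) ∧ (∀ z, ⟪n, σ z⟫_ℝ = ⟪n, c⟫_ℝ) ∧
      ∀ z, ‖σ z - c‖ = r * ‖z‖ := by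
  obtain ⟨L, P, hL, hPL, hLP⟩ := exists_linearIsometry_orthogonal hn
  refine ⟨fun z => c + r • L z, fun y => r⁻¹ • P (y - c), ?_, ?_, fun z => ?_, fun y hy => ?_,
    fun z => ?_, fun z => ?_⟩
  · exact contDiff_const.add (L.toContinuousLinearMap.contDiff.const_smul r)
  · exact (P.contDiff.comp (contDiff_id.sub contDiff_const)).const_smul r⁻¹
  · simp [hPL, smul_smul, hr.ne']
  · simp only [map_smul, smul_smul, mul_inv_cancel₀ hr.ne', one_smul]
    rw [hLP _ (by rw [inner_sub_right, hy, sub_self]), add_sub_cancel]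
  · simp [inner_add_right, real_inner_smul_right, hL]
  · simp [norm_smul, abs_of_pos hr]

theorem IsVectorPlaneDisc.exists_isDiscParam {D Γ : Set E3} (h : IsVectorPlaneDisc D Γ) :
    ∃ b t Φ Ψ, IsDiscParam D Γ b t Φ Ψ := by
  obtain ⟨c, n, r, hn, hc, hr, rfl, rfl⟩ := h
  have hn0 : n ≠ 0 := by
    rintro rfl
    simp at hn
  obtain ⟨σ, τ, hσ, hτ, hτσ, hστ, hσn, hσc⟩ := exists_affine_param hn0 c hr
  rw [hc] at hστ
  simp only [hc] at hσn
  refine ⟨n, 0, σ, τ, hn0, hσ, fun x _ => hτ.contDiffAt, hτσ, fun x _ hx => hστ x (by simpa using hx),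
    fun z => by simpa using hσn z, ?_, ?_⟩
  · ext x
    constructor
    · rintro ⟨z, hz, rfl⟩
      refine ⟨hσn z, ?_⟩
      rw [hσc]
      exact mul_le_of_le_one_right hr.le (by simpa using hz)
    · rintro ⟨hx, hxr⟩
      refine ⟨τ x, ?_, hστ x hx⟩
      rw [← hστ x hx, hσc] at hxr
      simpa using le_of_mul_le_mul_left (hxr.trans_eq (mul_one r).symm) hr
  · ext x
    constructor
    · rintro ⟨z, hz, rfl⟩
      refine ⟨hσn z, ?_⟩
      rw [hσc, mem_sphere_zero_iff_norm.1 hz, mul_one]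
    · rintro ⟨hx, hxr⟩
      refine ⟨τ x, ?_, hστ x hx⟩
      rw [← hστ x hx, hσc] at hxr
      simpa using mul_left_cancel₀ hr.ne' (hxr.trans (mul_one r).symm)

/-- The inversion in the unit sphere. -/
noncomputable def unitInversion (x : E3) : E3 := (⟪x, x⟫_ℝ)⁻¹ • x

theorem inner_unitInversion_self {x : E3} (hx : x ≠ 0) : ⟪unitInversion x, unitInversion x⟫_ℝ = (⟪x, x⟫_ℝ)⁻¹ := by
  have : ⟪x, x⟫_ℝ ≠ 0 := inner_self_ne_zero.2 hx
  rw [unitInversion, real_inner_smul_left, real_inner_smul_right, inv_mul_cancel₀ this, mul_one]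

theorem unitInversion_unitInversion {x : E3} (hx : x ≠ 0) : unitInversion (unitInversion x) = x := by
  have : ⟪x, x⟫_ℝ ≠ 0 := inner_self_ne_zero.2 hx
  rw [unitInversion, inner_unitInversion_self hx, inv_inv, unitInversion, smul_smul, mul_inv_cancel₀ this, one_smul]

theorem unitInversion_ne_zero {x : E3} (hx : x ≠ 0) : unitInversion x ≠ 0 :=
  smul_ne_zero (inv_ne_zero (inner_self_ne_zero.2 hx)) hx

theorem contDiffAt_unitInversion {x : E3} (hx : x ≠ 0) : ContDiffAt ℝ ∞ unitInversion x :=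
  ((contDiffAt_id.inner ℝ contDiffAt_id).inv (inner_self_ne_zero.2 hx)).smul contDiffAt_id

/-- Inversion maps the sphere to the plane ⟨a,y⟩ = 1/2 and the half-space t ≤ ⟨n,x⟩ to the ball of
radius 1/(2t) about n/(2t), without the origin. The cap thus becomes a round disc; 0 ∉ D is what
makes t positive. -/
theorem IsCapOfSphereThroughOrigin.exists_isDiscParam {D Γ : Set E3}
    (h : IsCapOfSphereThroughOrigin D Γ) (h0 : 0 ∉ D) : ∃ b t Φ Ψ, IsDiscParam D Γ b t Φ Ψ := by
  obtain ⟨a, n, t, ha, hn, ht, rfl, rfl⟩ := h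
  have htpos : 0 < t := by simpa using h0
  have hnn : ⟪n, n⟫_ℝ = 1 := by rw [real_inner_self_eq_norm_sq, hn, one_pow]
  have haa : 0 < ⟪a, a⟫_ℝ := real_inner_self_pos.2 ha
  -- The centre c is the orthogonal projection of n/(2t) to the plane ⟨a,y⟩ = 1/2, and r below comes
  -- from Pythagoras.
  set l := (t - ⟪n, a⟫_ℝ) / (2 * t * ⟪a, a⟫_ℝ) with hl
  set c := (2 * t)⁻¹ • n + l • a with hc
  have hlt : (t - ⟪n, a⟫_ℝ) ^ 2 < ⟪a, a⟫_ℝ := by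
    rw [real_inner_self_eq_norm_sq, sq_lt_sq, abs_norm]
    exact ht
  have hr2 : 0 < ((2 * t)⁻¹) ^ 2 - l ^ 2 * ⟪a, a⟫_ℝ := by
    have : ((2 * t)⁻¹) ^ 2 - l ^ 2 * ⟪a, a⟫_ℝ
        = (⟪a, a⟫_ℝ - (t - ⟪n, a⟫_ℝ) ^ 2) / ((2 * t) ^ 2 * ⟪a, a⟫_ℝ) := by
      rw [hl]
      field_simp
    rw [this]
    exact div_pos (sub_pos.2 hlt) (by positivity)
  set r := √(((2 * t)⁻¹) ^ 2 - l ^ 2 * ⟪a, a⟫_ℝ) with hr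
  have hrpos : 0 < r := Real.sqrt_pos.2 hr2
  have hac : ⟪a, c⟫_ℝ = 1 / 2 := by
    rw [hc, inner_add_right, real_inner_smul_right, real_inner_smul_right, hl,
      real_inner_comm]
    field_simp
    ring
  have hcc : ⟪c, c⟫_ℝ = r ^ 2 + l := by
    have h1 : ⟪c, c⟫_ℝ = (2 * t)⁻¹ * ⟪n, c⟫_ℝ + l * ⟪a, c⟫_ℝ := by
      conv_lhs => rw [hc, inner_add_left, real_inner_smul_left, real_inner_smul_left, ← hc]
    have h2 : ⟪n, c⟫_ℝ = (2 * t)⁻¹ + l * ⟪n, a⟫_ℝ := by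
      rw [hc, inner_add_right, real_inner_smul_right, real_inner_smul_right, hnn, mul_one]
    rw [h1, hac, h2, hr, Real.sq_sqrt hr2.le, hl]
    field_simp
    ring
  have hy0 : ∀ y, ⟪a, y⟫_ℝ = 1 / 2 → y ≠ 0 := by
    rintro y hy rfl
    norm_num at hy
  have hcy : ∀ y, ⟪a, y⟫_ℝ = 1 / 2 → 2 * ⟪c, y⟫_ℝ = t⁻¹ * ⟪n, y⟫_ℝ + l := fun y hy => by
    rw [hc, inner_add_left, real_inner_smul_left, real_inner_smul_left, hy]
    field_simp
  have hiy : ∀ y, y ≠ 0 → ⟪n, unitInversion y⟫_ℝ = ⟪n, y⟫_ℝ / ⟪y, y⟫_ℝ := fun y _ => by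
    rw [unitInversion, real_inner_smul_right, div_eq_inv_mul]
  have hle : ∀ y, ⟪a, y⟫_ℝ = 1 / 2 → (‖y - c‖ ≤ r ↔ t ≤ ⟪n, unitInversion y⟫_ℝ) := fun y hy => by
    have hyy : 0 < ⟪y, y⟫_ℝ := real_inner_self_pos.2 (hy0 y hy)
    rw [norm_sub_le_iff _ _ hrpos.le, hcy y hy, hcc, hiy y (hy0 y hy), le_div_iff₀ hyy,
      ← le_inv_mul_iff₀ htpos]
    constructor <;> intro h <;> linarith
  have heq : ∀ y, ⟪a, y⟫_ℝ = 1 / 2 → (‖y - c‖ = r ↔ ⟪n, unitInversion y⟫_ℝ = t) := fun y hy => by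
    have hyy : 0 < ⟪y, y⟫_ℝ := real_inner_self_pos.2 (hy0 y hy)
    rw [norm_sub_eq_iff _ _ hrpos.le, hcy y hy, hcc, hiy y (hy0 y hy), div_eq_iff hyy.ne',
      ← inv_mul_eq_iff_eq_mul₀ htpos.ne']
    constructor <;> intro h <;> linarith
  have hS : ∀ x, x ≠ 0 → (⟪x, x⟫_ℝ = 2 * ⟪a, x⟫_ℝ ↔ ⟪a, unitInversion x⟫_ℝ = 1 / 2) := fun x hx => by
    have hxx : 0 < ⟪x, x⟫_ℝ := real_inner_self_pos.2 hx
    rw [unitInversion, real_inner_smul_right, inv_mul_eq_div, div_eq_iff hxx.ne']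
    constructor <;> intro h <;> linarith
  obtain ⟨σ, τ, hσ, hτ, hτσ, hστ, hσn, hσc⟩ := exists_affine_param ha c hrpos
  rw [hac] at hστ
  simp only [hac] at hσn
  have hσ0 : ∀ z, σ z ≠ 0 := fun z => hy0 _ (hσn z)
  have hmem : ∀ z, ⟪unitInversion (σ z), unitInversion (σ z)⟫_ℝ = 2 * ⟪a, unitInversion (σ z)⟫_ℝ := fun z => by
    rw [hS _ (unitInversion_ne_zero (hσ0 z)), unitInversion_unitInversion (hσ0 z), hσn]
  have hright : ∀ x, x ≠ 0 → ⟪x, x⟫_ℝ = 2 * ⟪a, x⟫_ℝ → unitInversion (σ (τ (unitInversion x))) = x :=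
    fun x hx hxS => by rw [hστ _ ((hS x hx).1 hxS), unitInversion_unitInversion hx]
  have hball : ∀ z, z ∈ Metric.closedBall (0 : EuclideanSpace ℝ (Fin 2)) 1
      ↔ t ≤ ⟪n, unitInversion (σ z)⟫_ℝ := fun z => by
    rw [← hle _ (hσn z), hσc, mem_closedBall_zero_iff, mul_le_iff_le_one_right hrpos]
  have hsphere : ∀ z, z ∈ Metric.sphere (0 : EuclideanSpace ℝ (Fin 2)) 1
      ↔ ⟪n, unitInversion (σ z)⟫_ℝ = t := fun z => by
    rw [← heq _ (hσn z), hσc, mem_sphere_zero_iff_norm, mul_eq_left₀ hrpos.ne']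
  refine ⟨(2 : ℝ) • a, 1, fun z => unitInversion (σ z), fun x => τ (unitInversion x), smul_ne_zero two_ne_zero ha,
    contDiff_iff_contDiffAt.2 fun z => (contDiffAt_unitInversion (hσ0 z)).comp z hσ.contDiffAt,
    fun x hx => hτ.contDiffAt.comp x (contDiffAt_unitInversion hx),
    fun z => by rw [unitInversion_unitInversion (hσ0 z), hτσ],
    fun x hx hxS => hright x hx (by rw [← one_mul ⟪x, x⟫_ℝ, ← hxS, real_inner_smul_left]),
    fun z => by rw [real_inner_smul_left, one_mul, hmem], ?_, ?_⟩
  · ext x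
    simp only [mem_ofPred_eq]
    rw [norm_sub_eq_norm_iff]
    constructor
    · rintro ⟨z, hz, rfl⟩
      exact ⟨hmem z, (hball z).1 hz⟩
    · rintro ⟨hx, hxt⟩
      have hx0 : x ≠ 0 := by
        rintro rfl
        simp at hxt
        linarith
      exact ⟨τ (unitInversion x), (hball _).2 (by rwa [hright x hx0 hx]), hright x hx0 hx⟩
  · ext x
    simp only [mem_ofPred_eq]
    rw [norm_sub_eq_norm_iff]
    constructor
    · rintro ⟨z, hz, rfl⟩
      exact ⟨hmem z, (hsphere z).1 hz⟩
    · rintro ⟨hx, hxt⟩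
      have hx0 : x ≠ 0 := by
        rintro rfl
        simp at hxt
        linarith
      exact ⟨τ (unitInversion x), (hsphere _).2 (by rwa [hright x hx0 hx]), hright x hx0 hx⟩

/-! ### The closed unit disc as a surface with boundary -/

/-- The identification of the Euclidean plane with the complex numbers. -/
noncomputable def planeEquiv : EuclideanSpace ℝ (Fin 2) ≃ₗᵢ[ℝ] ℂ :=
  Complex.orthonormalBasisOneI.repr.symm

theorem planeEquiv_re (x : EuclideanSpace ℝ (Fin 2)) : (planeEquiv x).re = x 0 := by
  simp [planeEquiv]

theorem planeEquiv_symm_zero (z : ℂ) : planeEquiv.symm z 0 = z.re := by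
  rw [← planeEquiv_re, planeEquiv.apply_symm_apply]

/-- The Cayley transform of the closed right half-plane onto the closed unit disc without the point
`ε`, where `ε = ± 1`. -/
noncomputable def cayley (ε w : ℂ) : ℂ := ε * ((w - 1) / (w + 1))

/-- The inverse of `cayley ε`. -/
noncomputable def cayleyInv (ε z : ℂ) : ℂ := (1 + ε * z) / (1 - ε * z)

theorem add_one_ne_zero_of_re_nonneg {w : ℂ} (hw : 0 ≤ w.re) : w + 1 ≠ 0 := by
  intro h
  have := congrArg Complex.re h
  simp at this
  linarith

section Cayley

variable {ε : ℂ}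

theorem norm_eq_one_of_mul_self (hε : ε * ε = 1) : ‖ε‖ = 1 := by
  have h : ‖ε‖ * ‖ε‖ = 1 := by rw [← norm_mul, hε, norm_one]
  nlinarith [norm_nonneg ε]

theorem one_sub_mul_ne_zero (hε : ε * ε = 1) {z : ℂ} (hz : z ≠ ε) : 1 - ε * z ≠ 0 := by
  intro h
  refine hz ?_
  linear_combination (-ε) * h + z * (-hε)

theorem cayleyInv_cayley (hε : ε * ε = 1) {w : ℂ} (hw : w + 1 ≠ 0) :
    cayleyInv ε (cayley ε w) = w := by
  have h1 : ε * cayley ε w = (w - 1) / (w + 1) := by rw [cayley, ← mul_assoc, hε, one_mul]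
  rw [cayleyInv, h1]
  have h2 : 1 - (w - 1) / (w + 1) = 2 / (w + 1) := by
    field_simp
    ring
  rw [h2]
  field_simp
  ring

theorem cayley_cayleyInv (hε : ε * ε = 1) {z : ℂ} (hz : z ≠ ε) :
    cayley ε (cayleyInv ε z) = z := by
  have h := one_sub_mul_ne_zero hε hz
  have h1 : (cayleyInv ε z - 1) / (cayleyInv ε z + 1) = ε * z := by
    have h2 : cayleyInv ε z - 1 = 2 * (ε * z) / (1 - ε * z) := by
      rw [cayleyInv]
      field_simp
      ring
    have h3 : cayleyInv ε z + 1 = 2 / (1 - ε * z) := by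
      rw [cayleyInv]
      field_simp
      ring
    rw [h2, h3]
    field_simp
  rw [cayley, h1, ← mul_assoc, hε, one_mul]

theorem cayley_ne (hε : ε * ε = 1) {w : ℂ} (hw : w + 1 ≠ 0) : cayley ε w ≠ ε := by
  intro h
  have hε0 : ε ≠ 0 := by
    rintro rfl
    simp at hε
  have h1 : (w - 1) / (w + 1) = 1 := by
    refine mul_left_cancel₀ hε0 ?_
    rw [mul_one]
    exact h
  rw [div_eq_one_iff_eq hw] at h1
  have := congrArg Complex.re h1
  simp at this
  linarith

theorem cayleyInv_re (hε : ε * ε = 1) (z : ℂ) :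
    (cayleyInv ε z).re = (1 - ‖z‖ ^ 2) / Complex.normSq (1 - ε * z) := by
  have h : ‖z‖ ^ 2 = (ε * z).re * (ε * z).re + (ε * z).im * (ε * z).im := by
    rw [← Complex.normSq_apply, ← Complex.sq_norm, norm_mul, norm_eq_one_of_mul_self hε, one_mul]
  rw [cayleyInv, Complex.div_re, h, ← add_div]
  congr 1
  rw [Complex.add_re, Complex.add_im, Complex.sub_re, Complex.sub_im, Complex.one_re,
    Complex.one_im]
  ring

theorem cayleyInv_re_nonneg (hε : ε * ε = 1) {z : ℂ} (hz : ‖z‖ ≤ 1) : 0 ≤ (cayleyInv ε z).re := by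
  rw [cayleyInv_re hε]
  exact div_nonneg (by nlinarith [norm_nonneg z]) (Complex.normSq_nonneg _)

theorem cayleyInv_re_eq_zero_iff (hε : ε * ε = 1) {z : ℂ} (hz : z ≠ ε) :
    (cayleyInv ε z).re = 0 ↔ ‖z‖ = 1 := by
  rw [cayleyInv_re hε, div_eq_zero_iff, Complex.normSq_eq_zero,
    or_iff_left (one_sub_mul_ne_zero hε hz), sub_eq_zero, eq_comm,
    pow_eq_one_iff_of_nonneg (norm_nonneg z) two_ne_zero]

theorem norm_cayley_le (hε : ε * ε = 1) {w : ℂ} (hw : 0 ≤ w.re) : ‖cayley ε w‖ ≤ 1 := by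
  rw [cayley, norm_mul, norm_eq_one_of_mul_self hε, one_mul, norm_div]
  refine div_le_one_of_le₀ ?_ (norm_nonneg _)
  rw [← sq_le_sq₀ (norm_nonneg _) (norm_nonneg _), Complex.sq_norm, Complex.sq_norm,
    Complex.normSq_apply, Complex.normSq_apply]
  simp
  nlinarith

theorem contDiffAt_cayley {w : ℂ} (hw : w + 1 ≠ 0) : ContDiffAt ℝ ∞ (cayley ε) w := by
  unfold cayley
  exact contDiffAt_const.mul ((contDiffAt_id.sub contDiffAt_const).mul
    ((contDiffAt_id.add contDiffAt_const).inv hw))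

theorem contDiffAt_cayleyInv (hε : ε * ε = 1) {z : ℂ} (hz : z ≠ ε) :
    ContDiffAt ℝ ∞ (cayleyInv ε) z := by
  unfold cayleyInv
  exact (contDiffAt_const.add (contDiffAt_const.mul contDiffAt_id)).mul
    ((contDiffAt_const.sub (contDiffAt_const.mul contDiffAt_id)).inv (one_sub_mul_ne_zero hε hz))

end Cayley

/-- The closed unit disc of the complex plane. -/
def ClosedDisc : Type := Metric.closedBall (0 : ℂ) 1

namespace ClosedDisc

instance : TopologicalSpace ClosedDisc := inferInstanceAs (TopologicalSpace (Metric.closedBall _ _))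

instance : T2Space ClosedDisc := inferInstanceAs (T2Space (Metric.closedBall _ _))

instance : CompactSpace ClosedDisc :=
  isCompact_iff_compactSpace.1 (isCompact_closedBall (0 : ℂ) 1)

instance : ConnectedSpace ClosedDisc :=
  isConnected_iff_connectedSpace.1 ((convex_closedBall (0 : ℂ) 1).isConnected ⟨0, by simp⟩)

/-- The inclusion of the closed disc into the complex plane. -/
def val (p : ClosedDisc) : ℂ := Subtype.val p

theorem continuous_val : Continuous val := continuous_subtype_val

theorem val_injective : Function.Injective val := Subtype.val_injective

theorem norm_val_le (p : ClosedDisc) : ‖p.val‖ ≤ 1 := mem_closedBall_zero_iff.1 (Subtype.property p)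

theorem range_val : range val = Metric.closedBall 0 1 := Subtype.range_coe

/-- The chart of the closed disc without the point `ε = ± 1`, onto the closed half-plane. -/
noncomputable def discChart (ε : ℂ) (hε : ε * ε = 1) :
    OpenPartialHomeomorph ClosedDisc (EuclideanHalfSpace 2) where
  toFun p := ⟨planeEquiv.symm (cayleyInv ε p.val), by
    rw [planeEquiv_symm_zero]; exact cayleyInv_re_nonneg hε p.norm_val_le⟩
  invFun x := ⟨cayley ε (planeEquiv x.1), mem_closedBall_zero_iff.2 (norm_cayley_le hε (by
    rw [planeEquiv_re]; exact x.2))⟩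
  source := {p | p.val ≠ ε}
  target := univ
  map_source' _ _ := mem_univ _
  map_target' x _ := cayley_ne hε (add_one_ne_zero_of_re_nonneg (by
    rw [planeEquiv_re]; exact x.2))
  left_inv' p hp := Subtype.ext (by
    simp only [LinearIsometryEquiv.apply_symm_apply]
    exact cayley_cayleyInv hε hp)
  right_inv' x _ := Subtype.ext (by
    simp only [val]
    rw [cayleyInv_cayley hε (add_one_ne_zero_of_re_nonneg (by rw [planeEquiv_re]; exact x.2)),
      LinearIsometryEquiv.symm_apply_apply])
  open_source := isOpen_compl_singleton.preimage continuous_val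
  open_target := isOpen_univ
  continuousOn_toFun := by
    refine (Topology.IsInducing.subtypeVal.continuousOn_iff).2 ?_
    refine planeEquiv.symm.continuous.comp_continuousOn ?_
    intro p hp
    exact ((contDiffAt_cayleyInv hε hp).continuousAt.comp
      continuous_val.continuousAt).continuousWithinAt
  continuousOn_invFun := by
    refine (Topology.IsInducing.subtypeVal.continuousOn_iff).2 ?_
    intro x _
    have hx : planeEquiv x.1 + 1 ≠ 0 := add_one_ne_zero_of_re_nonneg (by
      rw [planeEquiv_re]; exact x.2)
    exact (ContinuousAt.comp (f := fun x : EuclideanHalfSpace 2 => planeEquiv x.1)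
      (contDiffAt_cayley hx).continuousAt
      (planeEquiv.continuous.comp continuous_subtype_val).continuousAt).continuousWithinAt

theorem val_ne_of_re_nonpos {p : ClosedDisc} (hp : p.val.re ≤ 0) : p.val ≠ 1 := fun h => by
  rw [h] at hp
  norm_num at hp

/-- Each Cayley chart omits one of the points 1 and -1; the sign of the real part selects a chart
whose omitted point lies on the other side. -/
noncomputable instance : ChartedSpace (EuclideanHalfSpace 2) ClosedDisc where
  atlas := {e | ∃ ε hε, e = discChart ε hε}
  chartAt p := if p.val.re ≤ 0 then discChart 1 (by norm_num) else discChart (-1) (by norm_num)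
  mem_chart_source p := by
    split_ifs with h
    · exact val_ne_of_re_nonpos h
    · intro h'
      rw [h'] at h
      norm_num at h
  chart_mem_atlas p := by
    split_ifs
    exacts [⟨_, _, rfl⟩, ⟨_, _, rfl⟩]

theorem planeEquiv_add_one_ne_zero {x : EuclideanSpace ℝ (Fin 2)} (hx : x ∈ range (𝓡∂ 2)) :
    planeEquiv x + 1 ≠ 0 := by
  rw [range_modelWithCornersEuclideanHalfSpace] at hx
  exact add_one_ne_zero_of_re_nonneg (by rw [planeEquiv_re]; exact hx)

theorem val_discChart_symm {ε : ℂ} (hε : ε * ε = 1) {x : EuclideanSpace ℝ (Fin 2)}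
    (hx : x ∈ range (𝓡∂ 2)) :
    val ((discChart ε hε).symm ((𝓡∂ 2).symm x)) = cayley ε (planeEquiv x) := by
  obtain ⟨y, rfl⟩ := hx
  rw [(𝓡∂ 2).left_inv]
  rfl

instance : IsManifold (𝓡∂ 2) ∞ ClosedDisc := by
  refine isManifold_of_contDiffOn _ _ _ ?_
  rintro _ _ ⟨ε, hε, rfl⟩ ⟨ε', hε', rfl⟩ x ⟨hx, hxr⟩
  have hne : cayley ε (planeEquiv x) ≠ ε' := by
    rw [← val_discChart_symm hε hxr]
    exact hx.2
  have h : ContDiffAt ℝ ∞ (fun x => planeEquiv.symm (cayleyInv ε' (cayley ε (planeEquiv x)))) x :=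
    planeEquiv.symm.contDiff.contDiffAt.comp x (ContDiffAt.comp (g := cayleyInv ε')
      (f := fun x => cayley ε (planeEquiv x)) x (contDiffAt_cayleyInv hε' hne)
      ((contDiffAt_cayley (planeEquiv_add_one_ne_zero hxr)).comp x planeEquiv.contDiff.contDiffAt))
  refine h.contDiffWithinAt.congr (fun y hy => ?_) ?_
  · exact congrArg (fun z => planeEquiv.symm (cayleyInv ε' z)) (val_discChart_symm hε hy.2)
  · exact congrArg (fun z => planeEquiv.symm (cayleyInv ε' z)) (val_discChart_symm hε hxr)

theorem exists_chartAt_eq (p : ClosedDisc) :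
    ∃ ε hε, chartAt (EuclideanHalfSpace 2) p = discChart ε hε ∧ p.val ≠ ε := by
  obtain ⟨ε, hε, h⟩ := chart_mem_atlas (EuclideanHalfSpace 2) p
  refine ⟨ε, hε, h, ?_⟩
  have := mem_chart_source (EuclideanHalfSpace 2) p
  rw [h] at this
  exact this

theorem isBoundaryPoint_iff (p : ClosedDisc) : (𝓡∂ 2).IsBoundaryPoint p ↔ ‖p.val‖ = 1 := by
  obtain ⟨ε, hε, h, hp⟩ := exists_chartAt_eq p
  rw [ModelWithCorners.isBoundaryPoint_iff, frontier_range_modelWithCornersEuclideanHalfSpace,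
    ← cayleyInv_re_eq_zero_iff hε hp, ← planeEquiv_symm_zero, eq_comm (b := (0 : ℝ))]
  simp only [extChartAt, h]
  rfl

theorem val_image_boundary : val '' (𝓡∂ 2).boundary ClosedDisc = Metric.sphere 0 1 := by
  ext z
  constructor
  · rintro ⟨p, hp, rfl⟩
    exact mem_sphere_zero_iff_norm.2 ((isBoundaryPoint_iff p).1 hp)
  · intro hz
    obtain ⟨p, rfl⟩ : z ∈ range val := range_val ▸ Metric.sphere_subset_closedBall hz
    exact ⟨p, (isBoundaryPoint_iff p).2 (mem_sphere_zero_iff_norm.1 hz), rfl⟩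

/-- The smooth coordinates of the plane on the closed disc. -/
noncomputable def coord (p : ClosedDisc) : EuclideanSpace ℝ (Fin 2) := planeEquiv.symm p.val

theorem coord_injective : Function.Injective coord :=
  planeEquiv.symm.injective.comp val_injective

theorem range_coord : range coord = Metric.closedBall 0 1 := by
  rw [show coord = planeEquiv.symm ∘ val from rfl, range_comp, range_val,
    LinearIsometryEquiv.image_closedBall, map_zero]

theorem coord_image_boundary : coord '' (𝓡∂ 2).boundary ClosedDisc = Metric.sphere 0 1 := by
  rw [show coord = planeEquiv.symm ∘ val from rfl, image_comp, val_image_boundary,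
    LinearIsometryEquiv.image_sphere, map_zero]

/-- G extends the chart expression across the edge of the half-plane, so that one-sided derivatives
become ordinary ones, and the smooth local left inverse R makes the derivative of G injective. -/
theorem exists_coord_extChartAt_symm (p : ClosedDisc) :
    ∃ G R : EuclideanSpace ℝ (Fin 2) → EuclideanSpace ℝ (Fin 2),
      EqOn (coord ∘ (extChartAt (𝓡∂ 2) p).symm) G (range (𝓡∂ 2)) ∧
      ContDiffAt ℝ ∞ G (extChartAt (𝓡∂ 2) p p) ∧
      ContDiffAt ℝ ∞ R (G (extChartAt (𝓡∂ 2) p p)) ∧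
      ∀ᶠ x in nhds (extChartAt (𝓡∂ 2) p p), R (G x) = x := by
  obtain ⟨ε, hε, h, hp⟩ := exists_chartAt_eq p
  have hmem : extChartAt (𝓡∂ 2) p p ∈ range (𝓡∂ 2) := mem_range_self _
  have hne := planeEquiv_add_one_ne_zero hmem
  refine ⟨fun x => planeEquiv.symm (cayley ε (planeEquiv x)),
    fun y => planeEquiv.symm (cayleyInv ε (planeEquiv y)), fun x hx => ?_, ?_, ?_, ?_⟩
  · refine congrArg planeEquiv.symm ?_
    rw [← val_discChart_symm hε hx, ← h]
    rfl
  · exact planeEquiv.symm.contDiff.contDiffAt.comp _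
      ((contDiffAt_cayley hne).comp _ planeEquiv.contDiff.contDiffAt)
  · refine planeEquiv.symm.contDiff.contDiffAt.comp _
      (ContDiffAt.comp (g := cayleyInv ε) _ ?_ planeEquiv.contDiff.contDiffAt)
    rw [planeEquiv.apply_symm_apply]
    exact contDiffAt_cayleyInv hε (cayley_ne hε hne)
  · have : Continuous fun x => planeEquiv x + 1 := planeEquiv.continuous.add continuous_const
    filter_upwards [this.continuousAt.eventually_ne hne] with x hx
    rw [planeEquiv.apply_symm_apply, cayleyInv_cayley hε hx, planeEquiv.symm_apply_apply]

theorem contMDiff_coord :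
    ContMDiff (𝓡∂ 2) 𝓘(ℝ, EuclideanSpace ℝ (Fin 2)) ∞ coord := fun p => by
  obtain ⟨G, R, hG, hGs, -, -⟩ := exists_coord_extChartAt_symm p
  refine contMDiffAt_iff.2
    ⟨(planeEquiv.symm.continuous.comp continuous_val).continuousAt, ?_⟩
  exact hGs.contDiffWithinAt.congr hG (hG (mem_range_self _))

theorem chartDeriv_coord_injective (p : ClosedDisc) :
    Function.Injective (chartDeriv coord p) := by
  obtain ⟨G, R, hG, hGs, hRs, hRG⟩ := exists_coord_extChartAt_symm p
  have hmem : extChartAt (𝓡∂ 2) p p ∈ range (𝓡∂ 2) := mem_range_self _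
  have h1 : chartDeriv coord p = fderiv ℝ G (extChartAt (𝓡∂ 2) p p) := by
    rw [chartDeriv, fderivWithin_congr hG (hG hmem),
      fderivWithin_eq_fderiv ((𝓡∂ 2).uniqueDiffOn _ hmem)
        (hGs.differentiableAt (by simp))]
  rw [h1]
  exact injective_fderiv_of_eventually_leftInverse (hGs.differentiableAt (by simp))
    (hRs.differentiableAt (by simp)) hRG

end ClosedDisc

/-! ### The two directions of the theorem -/

theorem nonpos_of_forall_le_mul {a b : ℝ} (h : ∀ ε > 0, a ≤ ε * b) : a ≤ 0 := by
  refine ge_of_tendsto (f := fun ε : ℝ => ε * b) (x := nhdsWithin 0 (Ioi 0)) ?_ ?_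
  · have : Continuous fun ε : ℝ => ε * b := by fun_prop
    simpa using (this.tendsto 0).mono_left nhdsWithin_le_nhds
  · filter_upwards [self_mem_nhdsWithin] with ε hε using h ε hε

section Uniqueness

variable {M : Type*} [TopologicalSpace M] [ChartedSpace (EuclideanHalfSpace 2) M]
  [IsManifold (𝓡∂ 2) ∞ M] [CompactSpace M] {f : M → E3} {b : E3} {t : ℝ}

theorem IsStationary.inner_le_of_boundary (hf : IsStationary (-4) f)
    (hB : ∀ q ∈ (𝓡∂ 2).boundary M, ⟪b, f q⟫_ℝ = t * ⟪f q, f q⟫_ℝ) (p : M) :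
    ⟪b, f p⟫_ℝ ≤ t * ⟪f p, f p⟫_ℝ := by
  have hpos : ∀ q, 0 < ⟪f q, f q⟫_ℝ := fun q => real_inner_self_pos.2 (hf.ne_zero q)
  have hc : Continuous f := hf.smooth.continuous
  have hcc : Continuous fun q => ⟪f q, f q⟫_ℝ := hc.inner hc
  -- The maximum of 1/|f|² is an error constant independent of ε.
  obtain ⟨k, -, hk⟩ := isCompact_univ.exists_isMaxOn ⟨p, mem_univ p⟩
    (hcc.inv₀ fun q => (hpos q).ne').continuousOn
  rw [← sub_nonpos]
  refine nonpos_of_forall_le_mul (b := (⟪f k, f k⟫_ℝ)⁻¹ * ⟪f p, f p⟫_ℝ) fun ε hε => ?_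
  obtain ⟨q, -, hq⟩ := isCompact_univ.exists_isMaxOn ⟨p, mem_univ p⟩
    ((((continuous_const (y := b)).inner hc).add (continuous_const (y := ε))).div hcc
      fun q => (hpos q).ne').continuousOn
  set m := (⟪b, f q⟫_ℝ + ε) / ⟪f q, f q⟫_ℝ with hm
  have hmax : ∀ x, (⟪b, f x⟫_ℝ + ε) / ⟪f x, f x⟫_ℝ ≤ m := fun x => hq (mem_univ x)
  have hmq : m * ⟪f q, f q⟫_ℝ = ⟪b, f q⟫_ℝ + ε := div_mul_cancel₀ _ (hpos q).ne'
  -- Maximality of m means `quad b ε m` is nonpositive on the surface with a zero at q; an interior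
  -- q would force ε ≤ 0.
  have hqB : q ∈ (𝓡∂ 2).boundary M := by
    by_contra hqB
    have hquad : quad b ε m (f q) = 0 := by rw [quad, hmq, sub_self]
    refine not_lt.2 (hf.nonpos_of_isLocalMax
      (((𝓡∂ 2).isInteriorPoint_iff_not_isBoundaryPoint q).2 hqB) hquad
      (Filter.Eventually.of_forall fun x => ?_)) hε
    change quad b ε m (f x) ≤ quad b ε m (f q)
    rw [hquad, quad, sub_nonpos]
    exact (div_le_iff₀ (hpos x)).1 (hmax x)
  have hmle : m ≤ t + ε * (⟪f k, f k⟫_ℝ)⁻¹ := by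
    have h1 : (⟪f q, f q⟫_ℝ)⁻¹ ≤ (⟪f k, f k⟫_ℝ)⁻¹ := hk (mem_univ q)
    rw [hm, hB q hqB, add_div, mul_div_cancel_right₀ _ (hpos q).ne', div_eq_mul_inv]
    gcongr
  have h2 := (div_le_iff₀ (hpos p)).1 ((hmax p).trans hmle)
  linarith

/-- A compact `-4`-stationary surface whose boundary lies in a plane or a sphere through the origin
lies in that plane or sphere. -/
theorem IsStationary.inner_eq_of_boundary (hf : IsStationary (-4) f)
    (hB : ∀ q ∈ (𝓡∂ 2).boundary M, ⟪b, f q⟫_ℝ = t * ⟪f q, f q⟫_ℝ) (p : M) :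
    ⟪b, f p⟫_ℝ = t * ⟪f p, f p⟫_ℝ := by
  refine (hf.inner_le_of_boundary hB p).antisymm ?_
  have := hf.inner_le_of_boundary (b := -b) (t := -t)
    (fun q hq => by rw [inner_neg_left, hB q hq, neg_mul]) p
  rw [inner_neg_left, neg_mul] at this
  exact neg_le_neg_iff.1 this

theorem IsStationary.injective_and_range_eq [T2Space M] [ConnectedSpace M]
    (hf : IsStationary (-4) f) {D Γ : Set E3} {Φ : EuclideanSpace ℝ (Fin 2) → E3}
    {Ψ : E3 → EuclideanSpace ℝ (Fin 2)} (h : IsDiscParam D Γ b t Φ Ψ)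
    (hΓ : f '' (𝓡∂ 2).boundary M = Γ) : Function.Injective f ∧ range f = D := by
  have hS : ∀ p, ⟪b, f p⟫_ℝ = t * ⟪f p, f p⟫_ℝ := hf.inner_eq_of_boundary fun q hq => by
    have : f q ∈ Φ '' Metric.sphere 0 1 := by
      rw [h.image_sphere, ← hΓ]
      exact mem_image_of_mem f hq
    obtain ⟨z, -, hz⟩ := this
    rw [← hz]
    exact h.inner_eq z
  have hfac : Φ ∘ (Ψ ∘ f) = f := funext fun p => h.right_inv _ (hf.ne_zero p) (hS p)
  have hsm : ContMDiff (𝓡∂ 2) 𝓘(ℝ, EuclideanSpace ℝ (Fin 2)) ∞ (Ψ ∘ f) := fun p =>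
    (h.contDiffAt_inv _ (hf.ne_zero p)).contMDiffAt.comp p (hf.smooth p)
  -- Since f = Φ ∘ (Ψ ∘ f) is an immersion, the chain rule makes the inner factor an immersion.
  have hd : ∀ p, Function.Injective (chartDeriv (Ψ ∘ f) p) := fun p => by
    have h1 := (injective_mfderiv_iff hf.smooth p).1 (hf.immersion p)
    rw [← hfac, chartDeriv_comp hsm p (h.contDiff.differentiable (by simp) _)] at h1
    exact Function.Injective.of_comp h1
  have hB : (Ψ ∘ f) '' (𝓡∂ 2).boundary M = Metric.sphere 0 1 := by
    rw [image_comp, hΓ, ← h.image_sphere, ← image_comp,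
      show Ψ ∘ Φ = id from funext h.left_inv, image_id]
  obtain ⟨hinj, hrange⟩ := injective_and_range_eq_closedBall hsm hd hB
  rw [← hfac]
  refine ⟨(Function.LeftInverse.injective h.left_inv).comp hinj, ?_⟩
  rw [range_comp, hrange, h.image_closedBall]

end Uniqueness

theorem IsDiscParam.exists_isStationary {D Γ : Set E3} {b : E3} {t : ℝ}
    {Φ : EuclideanSpace ℝ (Fin 2) → E3} {Ψ : E3 → EuclideanSpace ℝ (Fin 2)}
    (h : IsDiscParam D Γ b t Φ Ψ) (h0 : (0 : E3) ∉ D) :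
    ∃ (f ν : ClosedDisc → E3), IsStationary (-4) f ∧ Continuous ν ∧
      (∀ p, IsUnitNormal f p (ν p)) ∧ Function.Injective f ∧ range f = D ∧
      f '' (𝓡∂ 2).boundary ClosedDisc = Γ := by
  have hrange : range (Φ ∘ ClosedDisc.coord) = D := by
    rw [range_comp, ClosedDisc.range_coord, h.image_closedBall]
  have hne : ∀ p, (Φ ∘ ClosedDisc.coord) p ≠ 0 := fun p hp => h0 (by
    rw [← hrange, ← hp]
    exact mem_range_self p)
  have hsm : ContMDiff (𝓡∂ 2) 𝓘(ℝ, E3) ∞ (Φ ∘ ClosedDisc.coord) :=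
    h.contDiff.contMDiff.comp ClosedDisc.contMDiff_coord
  have hinj : ∀ p, Function.Injective (mfderiv (𝓡∂ 2) 𝓘(ℝ, E3) (Φ ∘ ClosedDisc.coord) p) :=
    fun p => by
      have hΦ := h.contDiff.differentiable (by simp) (ClosedDisc.coord p)
      rw [injective_mfderiv_iff hsm, chartDeriv_comp ClosedDisc.contMDiff_coord p hΦ]
      exact (injective_fderiv_of_eventually_leftInverse hΦ
        ((h.contDiffAt_inv _ (hne p)).differentiableAt (by simp))
        (Filter.Eventually.of_forall h.left_inv)).comp (ClosedDisc.chartDeriv_coord_injective p)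
  obtain ⟨hst, hN, hν⟩ := isStationary_of_inner_eq hsm hinj hne h.ne_zero fun p => h.inner_eq _
  have hc : Continuous fun p => b - (2 * t) • (Φ ∘ ClosedDisc.coord) p :=
    continuous_const.sub (hsm.continuous.const_smul (2 * t))
  refine ⟨_, _, hst, (hc.norm.inv₀ fun p => norm_ne_zero_iff.2 (hN p)).smul hc, hν,
    (Function.LeftInverse.injective h.left_inv).comp ClosedDisc.coord_injective, hrange, ?_⟩
  rw [image_comp, ClosedDisc.coord_image_boundary, h.image_sphere]

end StationarySurface

theorem theoremt2 :
    (∀ (M : Type*) [TopologicalSpace M] [ChartedSpace (EuclideanHalfSpace 2) M]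
        [IsManifold (𝓡∂ 2) ∞ M] [T2Space M] [CompactSpace M] [ConnectedSpace M]
        (f : M → StationarySurface.E3) (Γ : Set StationarySurface.E3),
        StationarySurface.IsStationary (-4) f →
        StationarySurface.IsCircle Γ →
        f '' (𝓡∂ 2).boundary M = Γ →
        Function.Injective f ∧
          (StationarySurface.IsVectorPlaneDisc (Set.range f) Γ ∨
            StationarySurface.IsCapOfSphereThroughOrigin (Set.range f) Γ)) ∧
    (∀ D Γ : Set StationarySurface.E3,
        (StationarySurface.IsVectorPlaneDisc D Γ ∨
          StationarySurface.IsCapOfSphereThroughOrigin D Γ) →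
        (0 : StationarySurface.E3) ∉ D →
        StationarySurface.IsCircle Γ ∧
        ∃ (M : Type) (_ : TopologicalSpace M) (_ : ChartedSpace (EuclideanHalfSpace 2) M)
          (_ : IsManifold (𝓡∂ 2) ∞ M) (_ : T2Space M) (_ : CompactSpace M) (_ : ConnectedSpace M)
          (f : M → StationarySurface.E3) (ν : M → StationarySurface.E3),
          StationarySurface.IsStationary (-4) f ∧
          Continuous ν ∧ (∀ p : M, StationarySurface.IsUnitNormal f p (ν p)) ∧
          Function.Injective f ∧ Set.range f = D ∧ f '' (𝓡∂ 2).boundary M = Γ) := by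
  refine ⟨fun M _ _ _ _ _ _ f Γ hf hcirc hΓ => ?_, fun D Γ hD h0 => ⟨?_, ?_⟩⟩
  -- Of the two caps bounded by Γ on the sphere, the one avoiding the origin is used, as f avoids it
  -- too.
  · obtain ⟨D, hD | ⟨hD, h0⟩⟩ := hcirc.exists_disc
    · obtain ⟨b, t, Φ, Ψ, h⟩ := hD.exists_isDiscParam
      obtain ⟨hinj, hr⟩ := hf.injective_and_range_eq h hΓ
      exact ⟨hinj, .inl (hr ▸ hD)⟩
    · obtain ⟨b, t, Φ, Ψ, h⟩ := hD.exists_isDiscParam h0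
      obtain ⟨hinj, hr⟩ := hf.injective_and_range_eq h hΓ
      exact ⟨hinj, .inr (hr ▸ hD)⟩
  · exact hD.elim (fun h => h.isCircle) fun h => h.isCircle
  · obtain ⟨b, t, Φ, Ψ, h⟩ : ∃ b t Φ Ψ, StationarySurface.IsDiscParam D Γ b t Φ Ψ :=
      hD.elim (fun h => h.exists_isDiscParam) fun h => h.exists_isDiscParam h0
    obtain ⟨f, ν, hf⟩ := h.exists_isStationary h0
    exact ⟨StationarySurface.ClosedDisc, inferInstance, inferInstance, inferInstance,
      inferInstance, inferInstance, inferInstance, f, ν, hf⟩
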